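/- Let $M$ be a complex manifold with a half-flat holomorphic Grassmann structure, that is: holomorphic vector bundles $E$ (of finite rank) and $H$ (of rank $2$) over $M$, an isomorphism $T^*M\cong E\otimes H$ of holomorphic bundles (equivalently $TM\cong E^*\otimes H^*$), holomorphic connections $\nabla^E$ and $\nabla^H$ in these bundles with $\nabla^H$ flat, the linear connection $\nabla=\nabla^E\otimes\mathrm{Id}+\mathrm{Id}\otimes\nabla^H$ on $M$, and a $\nabla^H$-parallel nondegenerate fibrewise $2$-form $\omega_H$ on $H^*$. Suppose that the structure is admissible, i.e. that the torsion of $\nabla$, a section of $TM\otimes\Lambda^2T^*M$, has no component in $E^*\otimes\Lambda^2E\otimes S^3H$ (where $H^*$ is identified with $H$ by means of $\omega_H$). Let $\pi:S_H\to M$ be the harmonic space, the $\mathrm{Sp}(1,\mathbb C)=\mathrm{SL}(2,\mathbb C)$-principal bundle of all bases $(h_+,h_-)$ of the fibres of $H^*$ with $\omega_H(h_+,h_-)=1$, and assume that a $\nabla^H$-parallel symplectic frame $(h_1,h_2)$ of $H^*$ over $M$, with $\omega_H(h_1,h_2)=1$, is fixed, so that $S_H=M\times\mathrm{Sp}(1,\mathbb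 C)$. For $e\in E^*_{\pi(s)}$, $s=(h_+,h_-)\in S_H$, let $X^e_\pm|_s$ be the horizontal lift of $e\otimes h_\pm$ to $s$ with respect to $\nabla^H$. Let $r\ge 0$. All connections are holomorphic. A connection in $\mathbb C^r\times M\to M$ is called half-flat if its curvature satisfies $F(e\otimes h,e'\otimes h')=\omega_H(h,h')\,F^{(ee')}$ for all $e,e'\in E^*_x$ and $h,h'\in H^*_x$, $x\in M$, with $F^{(ee')}$ symmetric in $e,e'$. A connection in $\mathbb C^r\times S_H\to S_H$ is called half-flat if its curvature satisfies $F(X^e_+,X^{e'}_+)=0=F(X^e_-,X^{e'}_-)$, $F(X^e_+,X^{e'}_-)$ is symmetric in $e,e'$, and $F(v,\cdot)=0$ for all vertical vectors $v$ of $\pi$. Two connections $d+A$, $d+A'$ in a trivial bundle $\mathbb C^r\times N\to N$ are gauge equivalent if $A'=U^{-1}dU+U^{-1}AU$ for some holomorphic $U:N\to \mathrm{GL}(r,\mathbb C)$. Then every half-flat connection in $\mathbb C^r\times S_H\to S_H$ is gauge equivalent to the pull-back $\pi^*\nabla^M$ of a half-flat connection $\nabla^M$ in $\mathbb C^r\times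 M\to M$. Moreover, a connection in $\mathbb C^r\times M$ is half-flat if and only if its pull-back to $\mathbb C^r\times S_H$ is half-flat, and $\nabla^M\mapsto\pi^*\nabla^M$ induces a one-to-one correspondence between gauge equivalence classes of connections in $\mathbb C^r\times M$ and gauge equivalence classes of connections in $\mathbb C^r\times S_H$ satisfying $F(v,\cdot)=0$ for all vertical vectors $v$. -/

import Mathlib

open Bundle Set
open scoped Manifold ContDiff TensorProduct

noncomputable section

/-! ### The complex manifold `Sp(1, ℂ) = SL(2, ℂ)`

Entries are named as in `U = !![a, b; c, d]`. The two charts are `(a, b, c)` on `{a ≠ 0}` and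
`(a, c, d)` on `{c ≠ 0}`. -/

namespace SLTwo

/-- The complex Lie group `Sp(1, ℂ) = SL(2, ℂ)`, with the topology induced from `2 × 2` matrices. -/
abbrev SL2C : Type := Matrix.SpecialLinearGroup (Fin 2) ℂ

theorem det_eq (U : SL2C) : U.1 0 0 * U.1 1 1 - U.1 0 1 * U.1 1 0 = 1 := by
  have h := U.2
  rwa [Matrix.det_fin_two] at h

theorem continuous_entry (i j : Fin 2) : Continuous fun U : SL2C => U.1 i j :=
  (continuous_apply_apply i j).comp continuous_subtype_val

open Classical in
/-- The matrix with first row `(a, b)` and lower left entry `c`, when `a ≠ 0`. -/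
def invA (q : ℂ × ℂ × ℂ) : SL2C :=
  if h : q.1 ≠ 0 then
    ⟨!![q.1, q.2.1; q.2.2, (1 + q.2.1 * q.2.2) / q.1], by
      rw [Matrix.det_fin_two_of]; field_simp; ring⟩
  else 1

open Classical in
/-- The matrix with first column `(a, c)` and lower right entry `d`, when `c ≠ 0`. -/
def invB (q : ℂ × ℂ × ℂ) : SL2C :=
  if h : q.2.1 ≠ 0 then
    ⟨!![q.1, (q.1 * q.2.2 - 1) / q.2.1; q.2.1, q.2.2], by
      rw [Matrix.det_fin_two_of]; field_simp; ring⟩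
  else 1

theorem invA_val {q : ℂ × ℂ × ℂ} (h : q.1 ≠ 0) :
    (invA q).1 = !![q.1, q.2.1; q.2.2, (1 + q.2.1 * q.2.2) / q.1] := by
  simp [invA, h]

theorem invB_val {q : ℂ × ℂ × ℂ} (h : q.2.1 ≠ 0) :
    (invB q).1 = !![q.1, (q.1 * q.2.2 - 1) / q.2.1; q.2.1, q.2.2] := by
  simp [invB, h]

/-- The chart `U ↦ (a, b, c)` on `{a ≠ 0}`. -/
def chartA : OpenPartialHomeomorph SL2C (ℂ × ℂ × ℂ) where
  toFun U := (U.1 0 0, U.1 0 1, U.1 1 0)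
  invFun := invA
  source := {U | U.1 0 0 ≠ 0}
  target := {q | q.1 ≠ 0}
  map_source' _ h := h
  map_target' q h := by
    have h' : q.1 ≠ 0 := h
    simp [invA_val h', h']
  left_inv' U h := by
    have h' : U.1 0 0 ≠ 0 := h
    apply Subtype.ext
    rw [invA_val (by exact h')]
    have := det_eq U
    ext i j
    fin_cases i <;> fin_cases j <;> simp
    field_simp
    linear_combination this.symm
  right_inv' q h := by
    have h' : q.1 ≠ 0 := h
    simp [invA_val h']
  open_source := isOpen_ne_fun (continuous_entry 0 0) continuous_const
  open_target := isOpen_ne_fun continuous_fst continuous_const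
  continuousOn_toFun :=
    ((continuous_entry 0 0).prodMk
      ((continuous_entry 0 1).prodMk (continuous_entry 1 0))).continuousOn
  continuousOn_invFun := by
    have hind : Topology.IsInducing (fun U : SL2C => (U.1 : Matrix (Fin 2) (Fin 2) ℂ)) := ⟨rfl⟩
    refine hind.continuousOn_iff.2 ?_
    have : ContinuousOn (fun q : ℂ × ℂ × ℂ =>
        !![q.1, q.2.1; q.2.2, (1 + q.2.1 * q.2.2) / q.1]) {q | q.1 ≠ 0} := by
      refine continuousOn_pi.2 fun i => continuousOn_pi.2 fun j => ?_
      fin_cases i <;> fin_cases j <;> simp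
      · fun_prop
      · fun_prop
      · fun_prop
      · exact ContinuousOn.div (by fun_prop) (by fun_prop) fun q hq => hq
    exact this.congr fun q hq => invA_val hq

/-- The chart `U ↦ (a, c, d)` on `{c ≠ 0}`. -/
def chartB : OpenPartialHomeomorph SL2C (ℂ × ℂ × ℂ) where
  toFun U := (U.1 0 0, U.1 1 0, U.1 1 1)
  invFun := invB
  source := {U | U.1 1 0 ≠ 0}
  target := {q | q.2.1 ≠ 0}
  map_source' _ h := h
  map_target' q h := by
    have h' : q.2.1 ≠ 0 := h
    simp [invB_val h', h']
  left_inv' U h := by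
    have h' : U.1 1 0 ≠ 0 := h
    apply Subtype.ext
    rw [invB_val (by exact h')]
    have := det_eq U
    ext i j
    fin_cases i <;> fin_cases j <;> simp
    field_simp
    linear_combination this
  right_inv' q h := by
    have h' : q.2.1 ≠ 0 := h
    simp [invB_val h']
  open_source := isOpen_ne_fun (continuous_entry 1 0) continuous_const
  open_target := isOpen_ne_fun (by fun_prop) continuous_const
  continuousOn_toFun :=
    ((continuous_entry 0 0).prodMk
      ((continuous_entry 1 0).prodMk (continuous_entry 1 1))).continuousOn
  continuousOn_invFun := by
    have hind : Topology.IsInducing (fun U : SL2C => (U.1 : Matrix (Fin 2) (Fin 2) ℂ)) := ⟨rfl⟩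
    refine hind.continuousOn_iff.2 ?_
    have : ContinuousOn (fun q : ℂ × ℂ × ℂ =>
        !![q.1, (q.1 * q.2.2 - 1) / q.2.1; q.2.1, q.2.2]) {q | q.2.1 ≠ 0} := by
      refine continuousOn_pi.2 fun i => continuousOn_pi.2 fun j => ?_
      fin_cases i <;> fin_cases j <;> simp
      · fun_prop
      · exact ContinuousOn.div (by fun_prop) (by fun_prop) fun q hq => hq
      · fun_prop
      · fun_prop
    exact this.congr fun q hq => invB_val hq

open Classical in
instance instChartedSpace : ChartedSpace (ℂ × ℂ × ℂ) SL2C where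
  atlas := {chartA, chartB}
  chartAt U := if U.1 0 0 ≠ 0 then chartA else chartB
  mem_chart_source U := by
    by_cases h : U.1 0 0 = 0
    · have hd := det_eq U
      have hc : U.1 1 0 ≠ 0 := by
        intro hc
        simp [h, hc] at hd
      simp only [h, ne_eq, not_true_eq_false, if_false]
      exact hc
    · simp only [ne_eq, h, not_false_eq_true, if_true]
      exact h
  chart_mem_atlas U := by
    by_cases h : U.1 0 0 = 0 <;> simp [h]

instance instIsManifold : IsManifold 𝓘(ℂ, ℂ × ℂ × ℂ) ω SL2C := by
  apply isManifold_of_contDiffOn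
  have hAB : ContDiffOn ℂ ω (fun q : ℂ × ℂ × ℂ => (q.1, q.2.2, (1 + q.2.1 * q.2.2) / q.1))
      {q | q.1 ≠ 0} := by
    refine ContDiffOn.prodMk (by fun_prop) (ContDiffOn.prodMk (by fun_prop) ?_)
    exact ContDiffOn.div (by fun_prop) (by fun_prop) fun q hq => hq
  have hBA : ContDiffOn ℂ ω (fun q : ℂ × ℂ × ℂ => (q.1, (q.1 * q.2.2 - 1) / q.2.1, q.2.1))
      {q | q.2.1 ≠ 0} := by
    refine ContDiffOn.prodMk (by fun_prop) (ContDiffOn.prodMk ?_ (by fun_prop))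
    exact ContDiffOn.div (by fun_prop) (by fun_prop) fun q hq => hq
  have hid : ∀ (e : OpenPartialHomeomorph SL2C (ℂ × ℂ × ℂ)),
      ContDiffOn ℂ ω (𝓘(ℂ, ℂ × ℂ × ℂ) ∘ (e.symm ≫ₕ e) ∘ 𝓘(ℂ, ℂ × ℂ × ℂ).symm)
        (𝓘(ℂ, ℂ × ℂ × ℂ).symm ⁻¹' (e.symm ≫ₕ e).source ∩ range 𝓘(ℂ, ℂ × ℂ × ℂ)) := by
    intro e
    refine contDiffOn_id.congr fun q hq => ?_
    have hq' : q ∈ e.target := by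
      have := hq.1
      simp at this
      exact this.1
    simp [e.right_inv hq']
  rintro e e' (rfl | he) (rfl | he')
  · exact hid _
  · obtain rfl : e' = chartB := he'
    refine (hAB.mono ?_).congr fun q hq => ?_
    · intro q hq
      have := hq.1
      simp at this
      exact this.1
    · have h0 : q.1 ≠ 0 := by
        have := hq.1
        simp at this
        exact this.1
      have h1 : chartA.symm q = invA q := rfl
      have h2 : ∀ U, chartB U = (U.1 0 0, U.1 1 0, U.1 1 1) := fun _ => rfl
      simp [h1, h2, invA_val h0]
  · obtain rfl : e = chartB := he
    refine (hBA.mono ?_).congr fun q hq => ?_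
    · intro q hq
      have := hq.1
      simp at this
      exact this.1
    · have h0 : q.2.1 ≠ 0 := by
        have := hq.1
        simp at this
        exact this.1
      have h1 : chartB.symm q = invB q := rfl
      have h2 : ∀ U, chartA U = (U.1 0 0, U.1 0 1, U.1 1 0) := fun _ => rfl
      simp [h1, h2, invB_val h0]
  · obtain rfl : e = chartB := he
    obtain rfl : e' = chartB := he'
    exact hid _

end SLTwo

namespace HalfFlat

open SLTwo

/-! ### Holomorphic connections in the trivial bundle `ℂ^r × N → N` -/

section TrivialBundle

/-- `gl(r, ℂ)`, the endomorphisms of `ℂ^r`. -/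
abbrev Gl (r : ℕ) : Type := (Fin r → ℂ) →L[ℂ] (Fin r → ℂ)

variable {E : Type*} [NormedAddCommGroup E] [NormedSpace ℂ E]
  {H : Type*} [TopologicalSpace H] (I : ModelWithCorners ℂ E H)
  {N : Type*} [TopologicalSpace N] [ChartedSpace H N]

variable (N) in
/-- `gl(r, ℂ)`-valued 1-forms `A` on `N`. Such a form is the potential of the connection
`∇_X = X + A(X)` in the trivial bundle `ℂ^r × N → N`, and every connection in the trivial bundle is
of this form. -/
abbrev Potential (r : ℕ) : Type _ := ∀ x : N, TangentSpace I x →L[ℂ] Gl r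

variable {I} {r : ℕ}

/-- The coefficient of the 1-form `A` in the preferred chart at `x₀`, that is, the pull-back of `A`
under the inverse of this chart. -/
def inChart (A : Potential I N r) (x₀ : N) (y : E) : E →L[ℂ] Gl r :=
  (A ((extChartAt I x₀).symm y)).comp (mfderiv 𝓘(ℂ, E) I (extChartAt I x₀).symm y)

/-- A connection is holomorphic if the coefficients of its potential are holomorphic in every chart.
(Differentiability is over `ℂ`, so that `C^∞` means holomorphic.) -/
def IsHolomorphic (A : Potential I N r) : Prop :=
  ∀ x₀ : N, ContDiffOn ℂ ∞ (inChart A x₀) (extChartAt I x₀).target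

/-- The exterior derivative `dA(X, Y) = X A(Y) - Y A(X) - A([X, Y])` at the point `x`, computed for
the constant vector fields in the chart at `x`. -/
def dForm (A : Potential I N r) (x : N) (v w : TangentSpace I x) : Gl r :=
  fderiv ℂ (inChart A x) (extChartAt I x x) v w - fderiv ℂ (inChart A x) (extChartAt I x x) w v

/-- The curvature `F(X, Y) = X A(Y) - Y A(X) + [A(X), A(Y)] - A([X, Y])` of `∇_X = X + A(X)`. -/
def curvature (A : Potential I N r) (x : N) (v w : TangentSpace I x) : Gl r :=
  dForm A x v w + (A x v * A x w - A x w * A x v)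

/-- Gauge equivalence of connections in `ℂ^r × N`: there is a holomorphic `U : N → GL(r, ℂ)` with
`A'(X) = U⁻¹ (X U) + U⁻¹ A(X) U`. -/
def GaugeEquivalent (A A' : Potential I N r) : Prop :=
  ∃ U : N → (Gl r)ˣ, ContMDiff I 𝓘(ℂ, Gl r) ∞ (fun x => (U x : Gl r)) ∧
    ∀ (x : N) (v : TangentSpace I x),
      A' x v = ((U x)⁻¹ : (Gl r)ˣ) * mvfderiv I (fun y => (U y : Gl r)) x v
        + ((U x)⁻¹ : (Gl r)ˣ) * A x v * (U x : Gl r)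

end TrivialBundle

/-! ### Half-flat Grassmann structures -/

section Grassmann

variable {E₀ : Type*} [NormedAddCommGroup E₀] [NormedSpace ℂ E₀]
  {M : Type*} [TopologicalSpace M] [ChartedSpace E₀ M] [IsManifold 𝓘(ℂ, E₀) ∞ M]

section Connection

variable (E₀) (F : Type*) [NormedAddCommGroup F] [NormedSpace ℂ F]
  {V : M → Type*} [TopologicalSpace (TotalSpace F V)]
  [∀ x, AddCommGroup (V x)] [∀ x, Module ℂ (V x)] [∀ x, TopologicalSpace (V x)]
  [FiberBundle F V]

/-- `σ` is a holomorphic section over `u` of the holomorphic vector bundle `V` with fibre `F`. -/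
def HolSection (σ : Π x : M, V x) (u : Set M) : Prop :=
  ContMDiffOn 𝓘(ℂ, E₀) (𝓘(ℂ, E₀).prod 𝓘(ℂ, F)) ∞ (fun x => TotalSpace.mk' F x (σ x)) u

variable {E₀ F} [∀ x, IsTopologicalAddGroup (V x)] [∀ x, ContinuousSMul ℂ (V x)] [VectorBundle ℂ F V]

/-- The connection `∇` is holomorphic: it maps holomorphic sections over open sets to holomorphic
sections. -/
def HolConnection (cov : CovariantDerivative 𝓘(ℂ, E₀) F V) : Prop :=
  ∀ u : Set M, IsOpen u → ContMDiffCovariantDerivativeOn F ∞ cov.toFun u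

/-- The connection is flat: `∇_X ∇_Y σ - ∇_Y ∇_X σ - ∇_{[X, Y]} σ = 0` for all local holomorphic
vector fields `X`, `Y` and all local holomorphic sections `σ`. -/
def IsFlat (cov : CovariantDerivative 𝓘(ℂ, E₀) F V) : Prop :=
  ∀ u : Set M, IsOpen u → ∀ (X Y : Π x : M, TangentSpace 𝓘(ℂ, E₀) x) (σ : Π x : M, V x),
    HolSection E₀ E₀ X u → HolSection E₀ E₀ Y u → HolSection E₀ F σ u → ∀ x ∈ u,
      cov (fun y => cov σ y (Y y)) x (X x) - cov (fun y => cov σ y (X y)) x (Y x)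
        - cov σ x (VectorField.mlieBracket 𝓘(ℂ, E₀) X Y x) = 0

end Connection

variable [FiniteDimensional ℂ E₀]
variable (E₀)
  (F : Type*) [NormedAddCommGroup F] [NormedSpace ℂ F]
  (V : M → Type*) [TopologicalSpace (TotalSpace F V)]
  [∀ x, AddCommGroup (V x)] [∀ x, Module ℂ (V x)] [∀ x, TopologicalSpace (V x)]
  [∀ x, IsTopologicalAddGroup (V x)] [∀ x, ContinuousSMul ℂ (V x)]
  [FiberBundle F V] [VectorBundle ℂ F V]
  (F' : Type*) [NormedAddCommGroup F'] [NormedSpace ℂ F']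
  (K : M → Type*) [TopologicalSpace (TotalSpace F' K)]
  [∀ x, AddCommGroup (K x)] [∀ x, Module ℂ (K x)] [∀ x, TopologicalSpace (K x)]
  [∀ x, IsTopologicalAddGroup (K x)] [∀ x, ContinuousSMul ℂ (K x)]
  [FiberBundle F' K] [VectorBundle ℂ F' K]

/-- A half-flat holomorphic Grassmann structure on the complex manifold `M`. It is written in terms
of the bundles `V = E^*` (with fibre `F`) and `K = H^*` (with fibre `F'`), so that the isomorphism
`T^*M ≅ E ⊗ H` becomes `TM ≅ E^* ⊗ H^*`. The data are this isomorphism, holomorphic connections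
`∇^E`, `∇^H`, the latter flat, the linear connection `∇ = ∇^E ⊗ Id + Id ⊗ ∇^H` on `TM`, and a
`∇^H`-parallel nondegenerate fibrewise 2-form `ω_H` on `H^*`. -/
structure HalfFlatGrassmann where
  iso : ∀ x : M, V x ⊗[ℂ] K x ≃ₗ[ℂ] TangentSpace 𝓘(ℂ, E₀) x
  iso_hol : ∀ u : Set M, IsOpen u → ∀ (e : Π x, V x) (h : Π x, K x),
    HolSection E₀ F e u → HolSection E₀ F' h u →
      HolSection E₀ E₀ (fun x => iso x (e x ⊗ₜ[ℂ] h x)) u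
  nablaE : CovariantDerivative 𝓘(ℂ, E₀) F V
  nablaE_hol : HolConnection nablaE
  nablaH : CovariantDerivative 𝓘(ℂ, E₀) F' K
  nablaH_hol : HolConnection nablaH
  nablaH_flat : IsFlat nablaH
  nabla : CovariantDerivative 𝓘(ℂ, E₀) E₀ (TangentSpace 𝓘(ℂ, E₀) : M → Type _)
  nabla_hol : HolConnection nabla
  nabla_tmul : ∀ u : Set M, IsOpen u → ∀ (e : Π x, V x) (h : Π x, K x),
    HolSection E₀ F e u → HolSection E₀ F' h u → ∀ x ∈ u, ∀ X : TangentSpace 𝓘(ℂ, E₀) x,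
      nabla (fun y => iso y (e y ⊗ₜ[ℂ] h y)) x X
        = iso x (nablaE e x X ⊗ₜ[ℂ] h x + e x ⊗ₜ[ℂ] nablaH h x X)
  omega : ∀ x : M, K x →ₗ[ℂ] K x →ₗ[ℂ] ℂ
  omega_alt : ∀ x, (omega x).IsAlt
  omega_nondeg : ∀ x, (omega x).Nondegenerate
  omega_hol : ∀ u : Set M, IsOpen u → ∀ h h' : Π x, K x,
    HolSection E₀ F' h u → HolSection E₀ F' h' u →
      ContMDiffOn 𝓘(ℂ, E₀) 𝓘(ℂ, ℂ) ∞ (fun x => omega x (h x) (h' x)) u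
  omega_parallel : ∀ u : Set M, IsOpen u → ∀ h h' : Π x, K x,
    HolSection E₀ F' h u → HolSection E₀ F' h' u → ∀ x ∈ u, ∀ X : TangentSpace 𝓘(ℂ, E₀) x,
      mvfderiv 𝓘(ℂ, E₀) (fun y => omega y (h y) (h' y)) x X
        = omega x (nablaH h x X) (h' x) + omega x (h x) (nablaH h' x X)

variable {E₀ F V F' K}

namespace HalfFlatGrassmann

variable (G : HalfFlatGrassmann E₀ F V F' K)

/-- The tangent vector `e ⊗ h`, for `e ∈ E^*_x` and `h ∈ H^*_x`. -/
def vec (x : M) (e : V x) (h : K x) : TangentSpace 𝓘(ℂ, E₀) x := G.iso x (e ⊗ₜ[ℂ] h)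

/-- The contraction `E^* ⊗ H^* → E^*`, `e ⊗ k ↦ ω_H(k, h) e`. -/
def contract (x : M) (h : K x) : TangentSpace 𝓘(ℂ, E₀) x →ₗ[ℂ] V x :=
  (TensorProduct.rid ℂ (V x)).toLinearMap ∘ₗ
    (LinearMap.lTensor (V x) ((G.omega x).flip h)) ∘ₗ (G.iso x).symm.toLinearMap

/-- The component in `E^* ⊗ Λ²E ⊗ S³H` of the torsion
`T(X, Y) = ∇_X Y - ∇_Y X - [X, Y]` of `∇`: the `H^*`-factor of the value of `T` is turned into a third
`H`-index by means of `ω_H`, and the result is symmetrised in the three `H`-indices and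
skew-symmetrised in the two `E`-indices. -/
def torsionSCubed (x : M) (e e' : V x) (h : Fin 3 → K x) : V x :=
  (12 : ℂ)⁻¹ • ∑ σ : Equiv.Perm (Fin 3),
    (G.contract x (h (σ 2)) (G.nabla.torsion x (G.vec x e (h (σ 0))) (G.vec x e' (h (σ 1))))
      - G.contract x (h (σ 2)) (G.nabla.torsion x (G.vec x e' (h (σ 0))) (G.vec x e (h (σ 1)))))

/-- The half-flat Grassmann structure is admissible: the torsion of `∇` has no component in
`E^* ⊗ Λ²E ⊗ S³H`. -/
def Admissible : Prop :=
  ∀ (x : M) (e e' : V x) (h : Fin 3 → K x), G.torsionSCubed x e e' h = 0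

/-- A `∇^H`-parallel symplectic frame `(h₁, h₂)` of `H^*` over `M`. -/
structure ParallelFrame where
  h₁ : Π x : M, K x
  h₂ : Π x : M, K x
  hol₁ : HolSection E₀ F' h₁ univ
  hol₂ : HolSection E₀ F' h₂ univ
  parallel₁ : ∀ x, G.nablaH h₁ x = 0
  parallel₂ : ∀ x, G.nablaH h₂ x = 0
  symplectic : ∀ x, G.omega x (h₁ x) (h₂ x) = 1

/-- A connection in `ℂ^r × M → M` is half-flat if its curvature satisfies
`F(e ⊗ h, e' ⊗ h') = ω_H(h, h') F^{(e e')}` with `F^{(e e')}` symmetric in `e, e' ∈ E^*`. -/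
def IsHalfFlat {r : ℕ} (A : Potential 𝓘(ℂ, E₀) M r) : Prop :=
  ∀ x : M, ∃ S : V x → V x → Gl r, (∀ e e', S e e' = S e' e) ∧
    ∀ (e e' : V x) (h h' : K x),
      curvature A x (G.vec x e h) (G.vec x e' h') = G.omega x h h' • S e e'

end HalfFlatGrassmann

/-! ### Harmonic space -/

/-- The model with corners of harmonic space. -/
abbrev modelS (E₀ : Type*) [NormedAddCommGroup E₀] [NormedSpace ℂ E₀] :
    ModelWithCorners ℂ (E₀ × ℂ × ℂ × ℂ) (ModelProd E₀ (ℂ × ℂ × ℂ)) :=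
  𝓘(ℂ, E₀).prod 𝓘(ℂ, ℂ × ℂ × ℂ)

/-- The harmonic space `S_H`, in the trivialisation `S_H = M × Sp(1, ℂ)` given by a parallel
symplectic frame `(h₁, h₂)`: the point `(x, U)` is the symplectic basis `(h₊, h₋)` of `H^*_x` with
`h₊ = u₊¹ h₁ + u₊² h₂`, `h₋ = u₋¹ h₁ + u₋² h₂`, where `U = !![u₊¹, u₋¹; u₊², u₋²]`
(see `ParallelFrame.frame_bijective`). The projection `π : S_H → M` is `Prod.fst`. -/
abbrev Harmonic (M : Type*) : Type _ := M × SL2C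

namespace HalfFlatGrassmann.ParallelFrame

variable {G : HalfFlatGrassmann E₀ F V F' K} (s : G.ParallelFrame)

/-- The vector `h₊` of the symplectic basis `p ∈ S_H`. -/
def hPlus (p : Harmonic M) : K p.1 := p.2.1 0 0 • s.h₁ p.1 + p.2.1 1 0 • s.h₂ p.1

/-- The vector `h₋` of the symplectic basis `p ∈ S_H`. -/
def hMinus (p : Harmonic M) : K p.1 := p.2.1 0 1 • s.h₁ p.1 + p.2.1 1 1 • s.h₂ p.1

end HalfFlatGrassmann.ParallelFrame

/-- The horizontal lift to `p ∈ S_H` of a tangent vector `Y` on `M` with respect to `∇^H`. As the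
frame which trivialises `S_H` is parallel, it is the horizontal lift with respect to the splitting
`S_H = M × Sp(1, ℂ)`. -/
def horizontalLift (p : Harmonic M) (Y : TangentSpace 𝓘(ℂ, E₀) p.1) :
    TangentSpace (modelS E₀) p :=
  mfderiv 𝓘(ℂ, E₀) (modelS E₀) (fun x : M => ((x, p.2) : Harmonic M)) p.1 Y

theorem mfderiv_fst_horizontalLift (p : Harmonic M) (Y : TangentSpace 𝓘(ℂ, E₀) p.1) :
    mfderiv (modelS E₀) 𝓘(ℂ, E₀) (Prod.fst : Harmonic M → M) p (horizontalLift p Y) = Y := by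
  unfold horizontalLift
  rw [mfderiv_prod_left, mfderiv_fst]
  rfl

theorem mfderiv_snd_horizontalLift (p : Harmonic M) (Y : TangentSpace 𝓘(ℂ, E₀) p.1) :
    mfderiv (modelS E₀) 𝓘(ℂ, ℂ × ℂ × ℂ) (Prod.snd : Harmonic M → SL2C) p (horizontalLift p Y)
      = 0 := by
  unfold horizontalLift
  rw [mfderiv_prod_left, mfderiv_snd]
  rfl

/-- The curvature constraint `F(v, ·) = 0` for all vertical vectors `v` of `π : S_H → M`. -/
def VerticallyNull {r : ℕ} (A : Potential (modelS E₀) (Harmonic M) r) : Prop :=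
  ∀ (p : Harmonic M) (v w : TangentSpace (modelS E₀) p),
    mfderiv (modelS E₀) 𝓘(ℂ, E₀) (Prod.fst : Harmonic M → M) p v = 0 → curvature A p v w = 0

/-- The potential of the pull-back connection `π^* ∇` under `π : S_H → M`. -/
def pullback {r : ℕ} (B : Potential 𝓘(ℂ, E₀) M r) : Potential (modelS E₀) (Harmonic M) r :=
  fun p => (B p.1).comp (mfderiv (modelS E₀) 𝓘(ℂ, E₀) (Prod.fst : Harmonic M → M) p)

namespace HalfFlatGrassmann.ParallelFrame

variable {G : HalfFlatGrassmann E₀ F V F' K} (s : G.ParallelFrame)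

/-- The value at `p = (h₊, h₋)` of `X₊^e`: the horizontal lift of `e ⊗ h₊`. -/
def XPlus (p : Harmonic M) (e : V p.1) : TangentSpace (modelS E₀) p :=
  horizontalLift p (G.vec p.1 e (s.hPlus p))

/-- The value at `p = (h₊, h₋)` of `X₋^e`: the horizontal lift of `e ⊗ h₋`. -/
def XMinus (p : Harmonic M) (e : V p.1) : TangentSpace (modelS E₀) p :=
  horizontalLift p (G.vec p.1 e (s.hMinus p))

/-- A connection in `ℂ^r × S_H → S_H` is half-flat if `F(X₊^e, X₊^e') = 0 = F(X₋^e, X₋^e')`,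
`F(X₊^e, X₋^e')` is symmetric in `e, e'`, and `F(v, ·) = 0` for all vertical `v`. -/
def IsHalfFlatS {r : ℕ} (A : Potential (modelS E₀) (Harmonic M) r) : Prop :=
  (∀ (p : Harmonic M) (e e' : V p.1), curvature A p (s.XPlus p e) (s.XPlus p e') = 0) ∧
  (∀ (p : Harmonic M) (e e' : V p.1),
    curvature A p (s.XPlus p e) (s.XMinus p e') = curvature A p (s.XPlus p e') (s.XMinus p e)) ∧
  (∀ (p : Harmonic M) (e e' : V p.1), curvature A p (s.XMinus p e) (s.XMinus p e') = 0) ∧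
  VerticallyNull A

theorem omega_hPlus_hMinus (p : Harmonic M) :
    G.omega p.1 (s.hPlus p) (s.hMinus p) = 1 := by
  have h := det_eq p.2
  have h1 := s.symplectic p.1
  have h2 : G.omega p.1 (s.h₂ p.1) (s.h₁ p.1) = -1 := by
    rw [← (G.omega_alt p.1).neg, h1]
  simp only [hPlus, hMinus, map_add, map_smul, LinearMap.add_apply, LinearMap.smul_apply,
    smul_eq_mul, G.omega_alt p.1 (s.h₁ p.1), G.omega_alt p.1 (s.h₂ p.1), h1, h2]
  linear_combination h

/-- Every vector of `H^*_x` is a combination of `h₁` and `h₂`, as `H` has rank two. -/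
theorem expand (hF' : Module.finrank ℂ F' = 2) (x : M) (k : K x) :
    k = G.omega x k (s.h₂ x) • s.h₁ x + G.omega x (s.h₁ x) k • s.h₂ x := by
  have h12 := s.symplectic x
  have h21 : G.omega x (s.h₂ x) (s.h₁ x) = -1 := by
    rw [← (G.omega_alt x).neg, h12]
  have h11 := G.omega_alt x (s.h₁ x)
  have h22 := G.omega_alt x (s.h₂ x)
  have hK : Module.finrank ℂ (K x) = 2 := by
    rw [← hF']
    exact ((trivializationAt F' K x).continuousLinearEquivAt ℂ x
      (FiberBundle.mem_baseSet_trivializationAt' x)).toLinearEquiv.finrank_eq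
  have hli : LinearIndependent ℂ ![s.h₁ x, s.h₂ x] := by
    rw [LinearIndependent.pair_iff]
    intro a b hab
    constructor
    · have := congrArg (fun k => G.omega x k (s.h₂ x)) hab
      simpa [h12, h22] using this
    · have := congrArg (fun k => G.omega x (s.h₁ x) k) hab
      simpa [h12, h11] using this
  have hspan := hli.span_eq_top_of_card_eq_finrank (by simp [hK])
  have hk : k ∈ Submodule.span ℂ (range ![s.h₁ x, s.h₂ x]) := by
    rw [hspan]; trivial
  rw [Matrix.range_cons, Matrix.range_cons, Matrix.range_empty, union_empty, singleton_union,
    Submodule.mem_span_pair] at hk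
  obtain ⟨a, b, rfl⟩ := hk
  simp [h11, h12, h22]

/-- The identification of `{x} × Sp(1, ℂ)` with the set of symplectic bases of `H^*_x`. -/
theorem frame_bijective (hF' : Module.finrank ℂ F' = 2) (x : M) :
    Function.Bijective (fun U : SL2C =>
      (⟨(s.hPlus (x, U), s.hMinus (x, U)), s.omega_hPlus_hMinus (x, U)⟩ :
        {q : K x × K x // G.omega x q.1 q.2 = 1})) := by
  have h12 := s.symplectic x
  have h21 : G.omega x (s.h₂ x) (s.h₁ x) = -1 := by
    rw [← (G.omega_alt x).neg, h12]
  have h11 := G.omega_alt x (s.h₁ x)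
  have h22 := G.omega_alt x (s.h₂ x)
  constructor
  · intro U W hUW
    have h := congrArg Subtype.val hUW
    simp only [Prod.mk.injEq, hPlus, hMinus] at h
    obtain ⟨hp, hm⟩ := h
    apply Subtype.ext
    ext i j
    fin_cases i <;> fin_cases j
    · have := congrArg (fun k => G.omega x k (s.h₂ x)) hp
      simpa [h12, h22] using this
    · have := congrArg (fun k => G.omega x k (s.h₂ x)) hm
      simpa [h12, h22] using this
    · have := congrArg (fun k => G.omega x (s.h₁ x) k) hp
      simpa [h12, h11] using this
    · have := congrArg (fun k => G.omega x (s.h₁ x) k) hm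
      simpa [h12, h11] using this
  · rintro ⟨⟨k, l⟩, hkl⟩
    have hk := s.expand hF' x k
    have hl := s.expand hF' x l
    refine ⟨⟨!![G.omega x k (s.h₂ x), G.omega x l (s.h₂ x);
      G.omega x (s.h₁ x) k, G.omega x (s.h₁ x) l], ?_⟩, ?_⟩
    · rw [Matrix.det_fin_two_of]
      simp only at hkl
      rw [hk, hl] at hkl
      simp only [map_add, map_smul, LinearMap.add_apply, LinearMap.smul_apply, smul_eq_mul,
        h11, h12, h21, h22] at hkl
      linear_combination hkl
    · apply Subtype.ext
      simp only [Prod.mk.injEq, hPlus, hMinus]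
      exact ⟨by simpa using hk.symm, by simpa using hl.symm⟩

end HalfFlatGrassmann.ParallelFrame

end Grassmann

end HalfFlat

end

/-! Along a fibre of π the form `A` is a flat connection on a copy of SL(2, ℂ), which is connected
and simply connected. There is therefore exactly one frame parallel along each fibre with value 1 at
a fixed group element, and together these frames form a holomorphic U : S_H → GL(r, ℂ). After the
gauge transformation by U the potential vanishes on vertical vectors v. For such a potential F(v, X)
= 0 says that the coefficients do not change in the direction v, so they are constant along the
connected fibres and the connection is a pull-back (`exists_global_frame`,
`fderiv_eq_zero_of_flatCurvature`, `eq_pullback`, combined in `exists_gauge_eq_pullback`).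

The analytic content is holomorphy of U in all variables. Over a star-shaped fibre the frame is
radial parallel transport, the solution of W' = -βW with W(0) = 1. As an integral equation this
reads (1 - T_β) W = 1 in the Banach space of continuous functions on [0, 1]. The Volterra operator
T_β is linear in β and ‖T_β^n‖ is at most of order C^n/n!, so 1 - T_β is invertible and W is a
holomorphic function of β. Also β is a holomorphic function of the endpoint, as a map into that
Banach space (`contDiffOn_of_prod`). Vanishing curvature then makes the radially parallel frame
parallel in every fibre direction (`fderiv_transport_radial`).

Simple connectedness enters through an explicit cover. The three sets where a, c, or -a-c avoids
(-∞, 0] cover SL(2, ℂ), are star-shaped in suitable coordinates, have connected pairwise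
intersections and share a point. The local frames normalised at that point agree on overlaps by
uniqueness, so they glue.

Half-flatness is compared using naturality of curvature. Horizontal lifts project to e ⊗ h₊ and e ⊗
h₋, and the conditions on S_H at the basis (h₁, h₂) determine F on all of E^* ⊗ H^* by bilinearity,
since H has rank two. Injectivity on gauge classes comes from restricting to the section x ↦ (x, 1)
of π. -/

noncomputable section

/-! ### Smooth dependence on parameters of functions on a compact space -/

namespace CompactParameter

universe u v w

variable {K : Type*} [TopologicalSpace K]

section Evaluation

variable [CompactSpace K] {D F G : Type*} [NormedAddCommGroup D] [NormedSpace ℂ D]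
  [NormedAddCommGroup F] [NormedSpace ℂ F] [NormedAddCommGroup G] [NormedSpace ℂ G]

variable (K) in
/-- Pointwise application of a bilinear map to continuous functions. -/
def pointwise (m : D →L[ℂ] F →L[ℂ] G) : C(K, D) →L[ℂ] C(K, F) →L[ℂ] C(K, G) :=
  LinearMap.mkContinuous₂
    (LinearMap.mk₂ ℂ (fun (B : C(K, D)) (f : C(K, F)) =>
        (⟨fun t => m (B t) (f t), by fun_prop⟩ : C(K, G)))
      (fun B B' f => by ext t; simp) (fun c B f => by ext t; simp)
      (fun B f f' => by ext t; simp) (fun c B f => by ext t; simp)) ‖m‖ fun B f => by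
    refine (ContinuousMap.norm_le _ (by positivity)).2 fun t => ?_
    refine (m.le_opNorm₂ _ _).trans ?_
    gcongr
    · exact B.norm_coe_le_norm t
    · exact f.norm_coe_le_norm t

@[simp]
theorem pointwise_apply (m : D →L[ℂ] F →L[ℂ] G) (B : C(K, D)) (f : C(K, F)) (t : K) :
    pointwise K m B f t = m (B t) (f t) := rfl

variable (K F) in
/-- The constant functions. -/
def constL : F →L[ℂ] C(K, F) :=
  LinearMap.mkContinuous
    { toFun := ContinuousMap.const K
      map_add' := fun f g => rfl
      map_smul' := fun c f => rfl } 1 fun f => by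
    rw [one_mul]
    exact (ContinuousMap.norm_le _ (norm_nonneg f)).2 fun t => le_rfl

@[simp]
theorem constL_apply (f : F) (t : K) : constL K F f t = f := rfl

variable (K) in
/-- A continuous family of linear maps, as a linear map to continuous functions. -/
def uncurryL (m : D →L[ℂ] F →L[ℂ] G) : C(K, D) →L[ℂ] F →L[ℂ] C(K, G) :=
  ((ContinuousLinearMap.compL ℂ F C(K, F) C(K, G)).flip (constL K F)).comp (pointwise K m)

@[simp]
theorem uncurryL_apply (m : D →L[ℂ] F →L[ℂ] G) (B : C(K, D)) (f : F) (t : K) :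
    uncurryL K m B f t = m (B t) f := rfl

variable (K) in
/-- Composition with a linear map. -/
def compL (L : F →L[ℂ] G) : C(K, F) →L[ℂ] C(K, G) :=
  LinearMap.mkContinuous
    { toFun := fun f => ⟨fun t => L (f t), by fun_prop⟩
      map_add' := fun f g => by ext t; simp
      map_smul' := fun c f => by ext t; simp } ‖L‖ fun f => by
    refine (ContinuousMap.norm_le _ (by positivity)).2 fun t => ?_
    refine (L.le_opNorm _).trans ?_
    gcongr
    exact f.norm_coe_le_norm t

@[simp]
theorem compL_apply (L : F →L[ℂ] G) (f : C(K, F)) (t : K) : compL K L f t = L (f t) := rfl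

variable (F) in
/-- Evaluation at a point. -/
def evalL (t : K) : C(K, F) →L[ℂ] F :=
  LinearMap.mkContinuous
    { toFun := fun f => f t
      map_add' := fun f g => rfl
      map_smul' := fun c f => rfl } 1 fun f => by
    rw [one_mul]
    exact f.norm_coe_le_norm t

@[simp]
theorem evalL_apply (f : C(K, F)) (t : K) : evalL F t f = f t := rfl

end Evaluation

section Continuity

variable {Z P F : Type*} [TopologicalSpace Z] [TopologicalSpace P] [TopologicalSpace F]
  {h : Z × P → F} {O : Set (Z × P)} {c : K → P} {Ω : Set Z}

/-- Joint continuity is the same as continuity of the curried map for the compact-open topology,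
which for compact `K` is the topology of the supremum norm. -/
theorem continuousOn_of_prod {g : Z → C(K, F)} (hh : ContinuousOn h O) (hc : Continuous c)
    (hΩO : ∀ z ∈ Ω, ∀ k, (z, c k) ∈ O) (hg : ∀ z ∈ Ω, ∀ k, g z k = h (z, c k)) :
    ContinuousOn g Ω := by
  rw [continuousOn_iff_continuous_domRestrict]
  refine ContinuousMap.continuous_of_continuous_uncurry _ ?_
  have : Continuous fun q : Ω × K => h (q.1, c q.2) :=
    hh.comp_continuous (by fun_prop) fun q => hΩO q.1 q.1.2 q.2
  refine this.congr fun q => ?_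
  exact (hg q.1 q.1.2 q.2).symm

theorem exists_curry [Nonempty F] (hh : ContinuousOn h O) (hc : Continuous c)
    (hΩO : ∀ z ∈ Ω, ∀ k, (z, c k) ∈ O) :
    ∃ g : Z → C(K, F), ∀ z ∈ Ω, ∀ k, g z k = h (z, c k) := by
  classical
  -- Off `Ω` the value is an arbitrary constant; only the values on `Ω` are ever used.
  refine ⟨fun z => if hz : z ∈ Ω then
    ⟨fun k => h (z, c k), hh.comp_continuous (by fun_prop) fun k => hΩO z hz k⟩
    else ContinuousMap.const K (Classical.arbitrary F), fun z hz k => ?_⟩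
  simp [hz]

end Continuity

variable [CompactSpace K] {Z : Type u} [NormedAddCommGroup Z] [NormedSpace ℂ Z]
  {P : Type w} [NormedAddCommGroup P] [NormedSpace ℂ P]

/-- Continuity of `g'` in the supremum norm makes the pointwise derivatives close to their values at
`z` uniformly in `k`. The mean value inequality on a small ball then bounds the remainders of all
the functions `g · k` at once. The map `m` allows the derivative to be recorded in any space `D`
that acts by linear maps. -/
theorem hasFDerivAt_of_pointwise {D F : Type*} [NormedAddCommGroup D] [NormedSpace ℂ D]
    [NormedAddCommGroup F] [NormedSpace ℂ F] (m : D →L[ℂ] Z →L[ℂ] F) {Ω : Set Z} (hΩ : IsOpen Ω)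
    {g : Z → C(K, F)} {g' : Z → C(K, D)} (hcont : ContinuousOn g' Ω)
    (hd : ∀ z ∈ Ω, ∀ k, HasFDerivAt (fun z => g z k) (m (g' z k)) z) {z : Z} (hz : z ∈ Ω) :
    HasFDerivAt g (uncurryL K m (g' z)) z := by
  rw [hasFDerivAt_iff_isLittleO, Asymptotics.isLittleO_iff]
  intro ε hε
  have hM : 0 < ‖m‖ + 1 := by positivity
  have h1 : ∀ᶠ z' in nhds z, z' ∈ Ω ∧ ‖g' z' - g' z‖ < ε / (‖m‖ + 1) := by
    refine Filter.Eventually.and (hΩ.mem_nhds hz) ?_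
    have := (hcont.continuousAt (hΩ.mem_nhds hz)).sub (continuousAt_const (y := g' z))
    exact this.norm.eventually_lt_const (by simpa using div_pos hε hM)
  obtain ⟨δ, hδ, hball⟩ := Metric.eventually_nhds_iff_ball.1 h1
  filter_upwards [Metric.ball_mem_nhds z hδ] with z' hz'
  refine (ContinuousMap.norm_le _ (by positivity)).2 fun k => ?_
  have := (convex_ball z δ).norm_image_sub_le_of_norm_hasFDerivWithin_le'
    (f := fun z => g z k) (f' := fun z => m (g' z k)) (φ := m (g' z k)) (C := ε)
    (fun y hy => (hd y (hball y hy).1 k).hasFDerivWithinAt)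
    (fun y hy => ?_) (Metric.mem_ball_self hδ) hz'
  · simpa using this
  · rw [← map_sub]
    calc ‖m (g' y k - g' z k)‖ ≤ ‖m‖ * ‖g' y k - g' z k‖ := m.le_opNorm _
      _ ≤ (‖m‖ + 1) * (ε / (‖m‖ + 1)) := by
          gcongr
          · exact le_add_of_nonneg_right zero_le_one
          · exact ((g' y - g' z).norm_coe_le_norm k).trans (hball y hy).2.le
      _ = ε := by field_simp

/-- Induction on the order: the derivative of `g` in `z` is again a curried function, with the
partial derivative of `h` in place of `h`. Its values lie in `Z →L[ℂ] F`, so `F` is quantified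
inside the induction and lives in a universe closed under this operation. -/
theorem contDiffOn_nat_of_prod (n : ℕ) {O : Set (Z × P)} (hO : IsOpen O) {c : K → P}
    (hc : Continuous c) {Ω : Set Z} (hΩ : IsOpen Ω) (hΩO : ∀ z ∈ Ω, ∀ k, (z, c k) ∈ O) :
    ∀ {F : Type (max u v)} [NormedAddCommGroup F] [NormedSpace ℂ F] {h : Z × P → F},
      ContDiffOn ℂ n h O → ∀ {g : Z → C(K, F)}, (∀ z ∈ Ω, ∀ k, g z k = h (z, c k)) →
      ContDiffOn ℂ n g Ω := by
  induction n with
  | zero =>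
    intro F _ _ h hh g hg
    exact contDiffOn_zero.2 (continuousOn_of_prod hh.continuousOn hc hΩO hg)
  | succ n ih =>
    intro F _ _ h hh g hg
    have hd : ∀ z ∈ Ω, ∀ k, HasFDerivAt (fun z => g z k)
        ((fderiv ℂ h (z, c k)).comp (ContinuousLinearMap.inl ℂ Z P)) z := by
      intro z hz k
      have h1 : HasFDerivAt h (fderiv ℂ h (z, c k)) (z, c k) :=
        ((hh.contDiffAt (hO.mem_nhds (hΩO z hz k))).differentiableAt (by simp)).hasFDerivAt
      refine (h1.comp z (hasFDerivAt_prodMk_left z (c k))).congr_of_eventuallyEq ?_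
      filter_upwards [hΩ.mem_nhds hz] with z' hz'
      exact hg z' hz' k
    have hh' : ContDiffOn ℂ n
        (fun q => (fderiv ℂ h q).comp (ContinuousLinearMap.inl ℂ Z P)) O :=
      (hh.fderiv_of_isOpen hO (by exact_mod_cast le_rfl)).clm_comp contDiffOn_const
    obtain ⟨g', hg'⟩ := exists_curry hh'.continuousOn hc hΩO
    have hg's := ih hh' hg'
    have hd' := fun z (hz : z ∈ Ω) => hasFDerivAt_of_pointwise
      (ContinuousLinearMap.id ℂ (Z →L[ℂ] F)) hΩ hg's.continuousOn (fun z hz k => by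
        rw [hg' z hz k]; exact hd z hz k) hz
    have : ContDiffOn ℂ ((n : ℕ∞) + 1) g Ω := by
      refine (contDiffOn_succ_iff_fderiv_of_isOpen hΩ).2
        ⟨fun z hz => (hd' z hz).differentiableAt.differentiableWithinAt, by simp, ?_⟩
      refine ((uncurryL K (ContinuousLinearMap.id ℂ (Z →L[ℂ] F))).contDiff.comp_contDiffOn
        hg's).congr fun z hz => (hd' z hz).fderiv
    exact_mod_cast this

theorem contDiffOn_of_prod {F : Type v} [NormedAddCommGroup F] [NormedSpace ℂ F]
    {O : Set (Z × P)} (hO : IsOpen O) {c : K → P}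
    (hc : Continuous c) {Ω : Set Z} (hΩ : IsOpen Ω) (hΩO : ∀ z ∈ Ω, ∀ k, (z, c k) ∈ O)
    {h : Z × P → F} (hh : ContDiffOn ℂ ∞ h O) {g : Z → C(K, F)}
    (hg : ∀ z ∈ Ω, ∀ k, g z k = h (z, c k)) : ContDiffOn ℂ ∞ g Ω := by
  refine contDiffOn_infty.2 fun n => ?_
  -- Lifting `F` puts it in the universe in which the induction was carried out.
  let e : ULift.{u} F ≃L[ℂ] F := ContinuousLinearEquiv.ulift
  have h1 : ContDiffOn ℂ n (fun q => e.symm (h q)) O :=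
    e.symm.contDiff.comp_contDiffOn (contDiffOn_infty.1 hh n)
  have h2 := contDiffOn_nat_of_prod n hO hc hΩ hΩO h1
    (g := fun z => compL K (e.symm : F →L[ℂ] ULift.{u} F) (g z))
    (fun z hz k => by rw [← hg z hz k]; rfl)
  have h3 := (compL K (e : ULift.{u} F →L[ℂ] F)).contDiff.comp_contDiffOn (n := n) h2
  refine h3.congr fun z _ => ?_
  ext k
  simp

end CompactParameter

/-! ### Linear differential equations as Volterra equations -/

namespace Volterra

open MeasureTheory unitInterval CompactParameter

variable {F : Type*} [NormedAddCommGroup F] [NormedSpace ℂ F]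

/-- The extension of a continuous function on `[0, 1]` to the real line. -/
def ext (f : C(I, F)) (s : ℝ) : F := f (projIcc 0 1 zero_le_one s)

theorem continuous_ext (f : C(I, F)) : Continuous (ext f) :=
  f.continuous.comp continuous_projIcc

theorem ext_coe (f : C(I, F)) (t : I) : ext f t = f t := by
  simp [ext]

theorem ext_of_mem (f : C(I, F)) {t : ℝ} (ht : t ∈ Icc (0 : ℝ) 1) : ext f t = f ⟨t, ht⟩ :=
  ext_coe f ⟨t, ht⟩

theorem norm_ext_le (f : C(I, F)) (s : ℝ) : ‖ext f s‖ ≤ ‖f‖ := f.norm_coe_le_norm _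

theorem norm_integral_ext_le (f : C(I, F)) (t : I) : ‖∫ s in (0 : ℝ)..t, ext f s‖ ≤ ‖f‖ := by
  have h := intervalIntegral.norm_integral_le_of_norm_le_const (a := 0) (b := (t : ℝ))
    (f := ext f) (C := ‖f‖) fun s _ => norm_ext_le f s
  refine h.trans ?_
  have ht : |(t : ℝ) - 0| ≤ 1 := by
    rw [sub_zero, abs_of_nonneg t.2.1]; exact t.2.2
  simpa using mul_le_mul_of_nonneg_left ht (norm_nonneg f)

variable (F) in
/-- The primitive `f ↦ ∫₀ᵗ f` on continuous functions on `[0, 1]`. -/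
def primitive : C(I, F) →L[ℂ] C(I, F) :=
  LinearMap.mkContinuous
    { toFun := fun f => ⟨fun t => ∫ s in (0 : ℝ)..t, ext f s,
        (intervalIntegral.continuous_primitive
          (fun a b => (continuous_ext f).intervalIntegrable a b) 0).comp continuous_subtype_val⟩
      map_add' := fun f g => by
        ext t
        exact intervalIntegral.integral_add ((continuous_ext f).intervalIntegrable _ _)
          ((continuous_ext g).intervalIntegrable _ _)
      map_smul' := fun c f => by
        ext t
        exact intervalIntegral.integral_smul c (ext f) } 1 fun f => by
    rw [one_mul]
    exact (ContinuousMap.norm_le _ (norm_nonneg f)).2 fun t => norm_integral_ext_le f t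

theorem primitive_apply (f : C(I, F)) (t : I) :
    primitive F f t = ∫ s in (0 : ℝ)..t, ext f s := rfl

variable {D : Type*} [NormedAddCommGroup D] [NormedSpace ℂ D] (m : D →L[ℂ] F →L[ℂ] F)

/-- The Volterra operator `f ↦ ∫₀ᵗ m(B(s), f(s)) ds`, as a function of its kernel `B`. -/
def operator : C(I, D) →L[ℂ] C(I, F) →L[ℂ] C(I, F) :=
  (ContinuousLinearMap.compL ℂ C(I, F) C(I, F) C(I, F) (primitive F)).comp (pointwise I m)

theorem operator_apply (B : C(I, D)) (f : C(I, F)) :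
    operator m B f = primitive F (pointwise I m B f) := rfl

/-- The usual estimate for iterated integrals: each application of the operator integrates a
multiple of s^n, which raises the power of t by one and contributes the factor 1/(n + 1). -/
theorem norm_operator_pow_apply_le (B : C(I, D)) (f : C(I, F)) (n : ℕ) (t : I) :
    ‖(operator m B ^ n) f t‖ ≤ (‖m‖ * ‖B‖) ^ n * ‖f‖ / n.factorial * (t : ℝ) ^ n := by
  induction n generalizing t with
  | zero => simpa using f.norm_coe_le_norm t
  | succ n ih =>
    rw [pow_succ', mul_apply_eq_comp, operator_apply, primitive_apply]
    have h0 : (0 : ℝ) ≤ t := t.2.1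
    have hle : ∀ s ∈ Ioc (0 : ℝ) t,
        ‖ext (pointwise I m B ((operator m B ^ n) f)) s‖
          ≤ ‖m‖ * ‖B‖ * ((‖m‖ * ‖B‖) ^ n * ‖f‖ / n.factorial) * s ^ n := by
      intro s hs
      rw [ext_of_mem _ ⟨hs.1.le, hs.2.trans t.2.2⟩, pointwise_apply, mul_assoc]
      refine (m.le_opNorm₂ _ _).trans ?_
      gcongr
      · exact B.norm_coe_le_norm _
      · exact ih _
    refine (intervalIntegral.norm_integral_le_of_norm_le h0
      (Filter.Eventually.of_forall hle)
      (Continuous.intervalIntegrable (by fun_prop) _ _)).trans (le_of_eq ?_)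
    rw [intervalIntegral.integral_const_mul, integral_pow, Nat.factorial_succ]
    push_cast
    have : (n.factorial : ℝ) ≠ 0 := by positivity
    have : (n : ℝ) + 1 ≠ 0 := by positivity
    simp
    field_simp
    ring

theorem norm_operator_pow_le (B : C(I, D)) (n : ℕ) :
    ‖operator m B ^ n‖ ≤ (‖m‖ * ‖B‖) ^ n / n.factorial := by
  refine ContinuousLinearMap.opNorm_le_bound _ (by positivity) fun f => ?_
  refine (ContinuousMap.norm_le _ (by positivity)).2 fun t => ?_
  refine (norm_operator_pow_apply_le m B f n t).trans ?_
  rw [mul_div_right_comm]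
  exact mul_le_of_le_one_right (by positivity) (pow_le_one₀ t.2.1 t.2.2)

/-- A Neumann series inverts 1 - T^n, and this is the product of 1 - T with the commuting factor 1 +
T + ... + T^(n-1). So only some power of T has to be small, not T itself. -/
theorem isUnit_one_sub_of_norm_pow_lt_one {E : Type*} [NormedAddCommGroup E] [NormedSpace ℂ E]
    [CompleteSpace E] {T : E →L[ℂ] E} {n : ℕ} (h : ‖T ^ n‖ < 1) : IsUnit (1 - T) := by
  have h1 : IsUnit (1 - T ^ n) := (Units.oneSub _ h).isUnit
  rw [← mul_neg_geom_sum] at h1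
  refine ((Commute.isUnit_mul_iff ?_).1 h1).1
  exact (mul_neg_geom_sum _ _).trans (geom_sum_mul_neg _ _).symm

/-- Inversion is analytic on the units of a Banach algebra, and the operator depends linearly on
`B`. This is the source of all holomorphic dependence on parameters below. -/
theorem contDiff_inverse_one_sub_apply {E D : Type*} [NormedAddCommGroup E] [NormedSpace ℂ E]
    [CompleteSpace E] [NormedAddCommGroup D] [NormedSpace ℂ D] (T : D →L[ℂ] E →L[ℂ] E)
    (hT : ∀ B, IsUnit (1 - T B)) (c : E) :
    ContDiff ℂ ∞ fun B => Ring.inverse (1 - T B) c := by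
  rw [contDiff_iff_contDiffAt]
  intro B
  obtain ⟨u, hu⟩ := hT B
  have h1 : ContDiffAt ℂ ∞ (fun B => 1 - T B) B :=
    (contDiff_const.sub T.contDiff).contDiffAt
  have h2 : ContDiffAt ℂ ∞ Ring.inverse (1 - T B) := hu ▸ contDiffAt_ringInverse ℂ u
  exact (h2.comp B h1).clm_apply contDiffAt_const

variable [CompleteSpace F]

theorem isUnit_one_sub_operator (B : C(I, D)) : IsUnit (1 - operator m B) := by
  obtain ⟨n, hn⟩ := ((FloorSemiring.tendsto_pow_div_factorial_atTop (‖m‖ * ‖B‖)).eventually_lt_const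
    zero_lt_one).exists
  exact isUnit_one_sub_of_norm_pow_lt_one ((norm_operator_pow_le m B n).trans_lt hn)

/-- The solution of `f = c + ∫ B f`. -/
def solution (c : C(I, F)) (B : C(I, D)) : C(I, F) :=
  Ring.inverse (1 - operator m B) c

theorem solution_eq (c : C(I, F)) (B : C(I, D)) :
    solution m c B = c + primitive F (pointwise I m B (solution m c B)) := by
  have h := congrArg (fun T : C(I, F) →L[ℂ] C(I, F) => T c)
    (Ring.mul_inverse_cancel _ (isUnit_one_sub_operator m B))
  simp only [mul_apply_eq_comp, sub_apply,
    one_apply_eq_self, operator_apply] at h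
  exact sub_eq_iff_eq_add.1 h

-- Uniqueness for linear differential equations in integral form. Since `c` is an arbitrary
-- function, inhomogeneous equations are covered too.
variable {m} in
theorem eq_of_eq_add_primitive {B : C(I, D)} {c f g : C(I, F)}
    (hf : f = c + primitive F (pointwise I m B f))
    (hg : g = c + primitive F (pointwise I m B g)) : f = g := by
  have key : ∀ f : C(I, F), f = c + primitive F (pointwise I m B f) → f = solution m c B := by
    intro f hf
    have h1 : (1 - operator m B) f = c := by
      rw [sub_apply, one_apply_eq_self, operator_apply]
      exact sub_eq_iff_eq_add.2 hf
    have h := congrArg (fun T : C(I, F) →L[ℂ] C(I, F) => T f)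
      (Ring.inverse_mul_cancel _ (isUnit_one_sub_operator m B))
    simp only [mul_apply_eq_comp, h1, one_apply_eq_self] at h
    exact h.symm
  rw [key f hf, key g hg]

theorem contDiff_solution (c : C(I, F)) : ContDiff ℂ ∞ (solution m c) :=
  contDiff_inverse_one_sub_apply (operator m) (isUnit_one_sub_operator m) c

/-- The fundamental theorem of calculus turns a differential equation into a Volterra equation. The
function `f` is defined on the whole line so that two-sided derivatives make sense at 0 and 1. -/
theorem eq_add_primitive_of_hasDerivAt {f : ℝ → F} {g h : C(I, F)} (hf : ∀ t : I, g t = f t)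
    (hd : ∀ t : I, HasDerivAt f (h t) t) : g = ContinuousMap.const I (f 0) + primitive F h := by
  ext t
  have hsub : uIcc (0 : ℝ) t ⊆ Icc 0 1 := by
    rw [uIcc_of_le t.2.1]
    exact Icc_subset_Icc_right t.2.2
  have := intervalIntegral.integral_eq_sub_of_hasDerivAt (f := f) (f' := ext h) (a := 0)
    (b := (t : ℝ)) (fun s hs => by
      rw [ext_of_mem h (hsub hs)]; exact hd ⟨s, hsub hs⟩)
    ((continuous_ext h).intervalIntegrable _ _)
  simp [primitive_apply, this, hf]

theorem hasDerivAt_const_add_integral (a : F) (h : C(I, F)) (t : I) :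
    HasDerivAt (fun s : ℝ => a + ∫ x in (0 : ℝ)..s, ext h x) (h t) t := by
  rw [← ext_coe h t]
  exact (intervalIntegral.integral_hasDerivAt_right ((continuous_ext h).intervalIntegrable _ _)
    ((continuous_ext h).stronglyMeasurableAtFilter _ _) (continuous_ext h).continuousAt).const_add a

end Volterra

/-! ### Parallel frames along star-shaped fibres -/

namespace Volterra

open unitInterval CompactParameter

variable {𝔸 : Type*} [NormedRing 𝔸] [NormedAlgebra ℂ 𝔸]

/-- The curvature `dα + α ∧ α` of an algebra-valued 1-form on a normed space. -/
def flatCurvature {Z : Type*} [NormedAddCommGroup Z] [NormedSpace ℂ Z] (α : Z → Z →L[ℂ] 𝔸)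
    (z v w : Z) : 𝔸 :=
  fderiv ℂ α z v w - fderiv ℂ α z w v + (α z v * α z w - α z w * α z v)

variable [CompleteSpace 𝔸]

/-- The solution of `W' = -β W`, `W(0) = 1`. -/
def transport (β : C(I, 𝔸)) : C(I, 𝔸) :=
  solution (-ContinuousLinearMap.mul ℂ 𝔸) (ContinuousMap.const I 1) β

/-- The solution of `R' = R β`, `R(0) = 1`. -/
def transportInv (β : C(I, 𝔸)) : C(I, 𝔸) :=
  solution (ContinuousLinearMap.mul ℂ 𝔸).flip (ContinuousMap.const I 1) β

/-- A differentiable extension of a solution of an integral equation. -/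
theorem exists_hasDerivAt_of_eq_add_primitive {F : Type*} [NormedAddCommGroup F] [NormedSpace ℂ F]
    [CompleteSpace F] {a : F} {f h : C(I, F)} (hf : f = ContinuousMap.const I a + primitive F h) :
    ∃ w : ℝ → F, w 0 = a ∧ (∀ t : I, w t = f t) ∧ ∀ t : I, HasDerivAt w (h t) t := by
  refine ⟨fun s => a + ∫ x in (0 : ℝ)..s, ext h x, by simp, fun t => ?_,
    fun t => hasDerivAt_const_add_integral a h t⟩
  rw [hf]
  rfl

theorem exists_hasDerivAt_transport (β : C(I, 𝔸)) :
    ∃ w : ℝ → 𝔸, w 0 = 1 ∧ (∀ t : I, w t = transport β t) ∧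
      ∀ t : I, HasDerivAt w (-(β t * w t)) t := by
  obtain ⟨w, h0, hw, hd⟩ := exists_hasDerivAt_of_eq_add_primitive
    (solution_eq (-ContinuousLinearMap.mul ℂ 𝔸) (ContinuousMap.const I 1) β)
  refine ⟨w, h0, hw, fun t => ?_⟩
  have := hd t
  rw [pointwise_apply, ← hw] at this
  simpa using this

theorem exists_hasDerivAt_transportInv (β : C(I, 𝔸)) :
    ∃ w : ℝ → 𝔸, w 0 = 1 ∧ (∀ t : I, w t = transportInv β t) ∧
      ∀ t : I, HasDerivAt w (w t * β t) t := by
  obtain ⟨w, h0, hw, hd⟩ := exists_hasDerivAt_of_eq_add_primitive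
    (solution_eq (ContinuousLinearMap.mul ℂ 𝔸).flip (ContinuousMap.const I 1) β)
  refine ⟨w, h0, hw, fun t => ?_⟩
  have := hd t
  rw [pointwise_apply, ← hw] at this
  simpa using this

/-- The derivative of R W is RβW - RβW = 0, so the product keeps its initial value 1. -/
theorem transportInv_mul_transport (β : C(I, 𝔸)) (t : I) :
    transportInv β t * transport β t = 1 := by
  obtain ⟨w, w0, hw, hdw⟩ := exists_hasDerivAt_transport β
  obtain ⟨r, r0, hr, hdr⟩ := exists_hasDerivAt_transportInv β
  have := eq_add_primitive_of_hasDerivAt (g := transportInv β * transport β) (h := 0)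
    (f := fun s => r s * w s) (fun t => by simp [hw, hr])
    (fun t => by
      refine ((hdr t).mul (hdw t)).congr_deriv ?_
      simp [mul_assoc])
  simpa [w0, r0] using congrArg (fun f : C(I, 𝔸) => f t) this

/-- In this order the product X = W R is not visibly constant. It solves X' = Xβ - βX with X(0) = 1,
and so does the constant 1, whence uniqueness applies. A separate argument is needed because a left
inverse in a general Banach algebra need not be a right inverse. -/
theorem transport_mul_transportInv (β : C(I, 𝔸)) (t : I) :
    transport β t * transportInv β t = 1 := by
  obtain ⟨w, w0, hw, hdw⟩ := exists_hasDerivAt_transport β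
  obtain ⟨r, r0, hr, hdr⟩ := exists_hasDerivAt_transportInv β
  let m : 𝔸 →L[ℂ] 𝔸 →L[ℂ] 𝔸 :=
    (ContinuousLinearMap.mul ℂ 𝔸).flip - ContinuousLinearMap.mul ℂ 𝔸
  have h1 : transport β * transportInv β = ContinuousMap.const I 1
      + primitive 𝔸 (pointwise I m β (transport β * transportInv β)) := by
    have := eq_add_primitive_of_hasDerivAt (g := transport β * transportInv β)
      (h := pointwise I m β (transport β * transportInv β))
      (f := fun s => w s * r s) (fun t => by simp [hw, hr])
      (fun t => by
        refine ((hdw t).mul (hdr t)).congr_deriv ?_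
        simp [m, hw, hr, mul_assoc]
        abel)
    simpa [w0, r0] using this
  have h2 : (1 : C(I, 𝔸)) = ContinuousMap.const I 1
      + primitive 𝔸 (pointwise I m β 1) := by
    have h3 : pointwise I m β 1 = 0 := by
      ext t
      simp [m]
    rw [h3, map_zero, add_zero]
    rfl
  exact congrArg (fun f : C(I, 𝔸) => f t) (eq_of_eq_add_primitive h1 h2)

/-- Parallel transport along the path with connection coefficient `β`, as a unit. -/
def transportUnit (β : C(I, 𝔸)) (t : I) : 𝔸ˣ :=
  ⟨transport β t, transportInv β t, transport_mul_transportInv β t, transportInv_mul_transport β t⟩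

theorem contDiff_transport : ContDiff ℂ ∞ (transport : C(I, 𝔸) → C(I, 𝔸)) :=
  contDiff_solution _ _

/-- Differentiating the Volterra equation in the parameter gives an inhomogeneous Volterra equation
with the same kernel, which characterises the derivative. -/
theorem fderiv_transport {Z : Type*} [NormedAddCommGroup Z] [NormedSpace ℂ Z] {β : Z → C(I, 𝔸)}
    {z : Z} (hβ : DifferentiableAt ℂ β z) (v : Z) :
    fderiv ℂ (fun z => transport (β z)) z v
      = primitive 𝔸 (pointwise I (-ContinuousLinearMap.mul ℂ 𝔸) (fderiv ℂ β z v)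
          (transport (β z)))
        + primitive 𝔸 (pointwise I (-ContinuousLinearMap.mul ℂ 𝔸) (β z)
          (fderiv ℂ (fun z => transport (β z)) z v)) := by
  set m := -ContinuousLinearMap.mul ℂ 𝔸
  have hW : HasFDerivAt (fun z => transport (β z)) (fderiv ℂ (fun z => transport (β z)) z) z :=
    ((contDiff_transport.differentiable (by simp)).differentiableAt.comp z hβ).hasFDerivAt
  have h1 := ((primitive 𝔸).hasFDerivAt.comp z
    ((pointwise I m).hasFDerivAt_of_bilinear hβ.hasFDerivAt hW)).const_add (ContinuousMap.const I 1)
  have h2 : (fun z => transport (β z)) = fun z => ContinuousMap.const I (1 : 𝔸)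
      + primitive 𝔸 (pointwise I m (β z) (transport (β z))) :=
    funext fun z => solution_eq m _ (β z)
  have h3 := hW.unique (h1.congr_of_eventuallyEq (Filter.Eventually.of_forall (congrFun h2)))
  have h4 := congrArg (fun L : Z →L[ℂ] C(I, 𝔸) => L v) h3
  simp only [ContinuousLinearMap.comp_apply, add_apply, map_add,
    ContinuousLinearMap.precompR_apply, ContinuousLinearMap.precompL_apply] at h4
  rw [add_comm] at h4
  exact h4

section Radial

variable {Y Q : Type*} [NormedAddCommGroup Y] [NormedSpace ℂ Y] [NormedAddCommGroup Q]
  [NormedSpace ℂ Q]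

/-- The path `t ↦ (y, q₀ + t (q - q₀))`, for `z = (y, q)`. -/
def radial (q₀ : Q) (z : Y × Q) (t : ℂ) : Y × Q := (z.1, q₀ + t • (z.2 - q₀))

theorem contDiff_radial (q₀ : Q) :
    ContDiff ℂ ∞ fun p : (Y × Q) × ℂ => radial q₀ p.1 p.2 := by
  unfold radial
  fun_prop

theorem hasFDerivAt_radial (q₀ : Q) (z : Y × Q) (t : ℂ) (v : Q) :
    ∃ L : Y × Q →L[ℂ] Y × Q, HasFDerivAt (fun z => radial q₀ z t) L z ∧ L (0, v) = (0, t • v) := by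
  have h2 : HasFDerivAt (fun z : Y × Q => q₀ + t • (z.2 - q₀))
      (t • ContinuousLinearMap.snd ℂ Y Q) z :=
    ((hasFDerivAt_snd.sub_const q₀).const_smul t).const_add q₀
  exact ⟨_, hasFDerivAt_fst.prodMk h2, by simp⟩

theorem hasDerivAt_radial (q₀ : Q) (z : Y × Q) (t : ℂ) :
    HasDerivAt (radial q₀ z) (0, z.2 - q₀) t := by
  have h2 : HasDerivAt (fun s : ℂ => q₀ + s • (z.2 - q₀)) (z.2 - q₀) t := by
    simpa using ((hasDerivAt_id t).smul_const (z.2 - q₀)).const_add q₀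
  exact (hasDerivAt_const t z.1).prodMk h2

/-- The coefficient of a connection along the radial path. -/
def radialCoeff (α : Y × Q → Y × Q →L[ℂ] 𝔸) (q₀ : Q) (p : (Y × Q) × ℂ) : 𝔸 :=
  α (radial q₀ p.1 p.2) (0, p.1.2 - q₀)

-- The endpoint enters twice: through the point of the path, which moves with velocity t v, and
-- through the direction q - q₀ in which the form is evaluated.
omit [CompleteSpace 𝔸] in
theorem fderiv_radialCoeff {α : Y × Q → Y × Q →L[ℂ] 𝔸} {q₀ : Q} {z : Y × Q} {t : ℂ}
    (hα : DifferentiableAt ℂ α (radial q₀ z t)) (v : Q) :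
    fderiv ℂ (fun z => radialCoeff α q₀ (z, t)) z (0, v)
      = t • fderiv ℂ α (radial q₀ z t) (0, v) (0, z.2 - q₀) + α (radial q₀ z t) (0, v) := by
  obtain ⟨L, hL, hLv⟩ := hasFDerivAt_radial q₀ z t v
  have h1 : HasFDerivAt (fun z => α (radial q₀ z t)) _ z :=
    HasFDerivAt.comp z hα.hasFDerivAt hL
  have hs : HasFDerivAt (fun z : Y × Q => z.2 - q₀) (ContinuousLinearMap.snd ℂ Y Q) z :=
    hasFDerivAt_snd.sub_const q₀
  have h2 : HasFDerivAt (fun z : Y × Q => ((0 : Y), z.2 - q₀)) _ z :=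
    (hasFDerivAt_const (0 : Y) z).prodMk hs
  have h3 : HasFDerivAt (fun z => radialCoeff α q₀ (z, t)) _ z := h1.clm_apply h2
  have h4 : ((0 : Y), t • v) = t • ((0 : Y), v) := by simp
  rw [h3.fderiv]
  simp only [add_apply, ContinuousLinearMap.comp_apply, ContinuousLinearMap.flip_apply, hLv]
  rw [h4, map_smul]
  simp
  abel

/-- The covariant derivative of a radially parallel frame vanishes if the curvature does. -/
theorem fderiv_transport_radial {α : Y × Q → Y × Q →L[ℂ] 𝔸} {q₀ : Q} {z : Y × Q}
    {β : Y × Q → C(I, 𝔸)} (hβ : DifferentiableAt ℂ β z)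
    (hβα : ∀ᶠ z' in nhds z, ∀ t : I, β z' t = radialCoeff α q₀ (z', (t : ℝ)))
    (hα : ∀ t : I, DifferentiableAt ℂ α (radial q₀ z (t : ℝ))) (v : Q)
    (hF : ∀ t : I, flatCurvature α (radial q₀ z (t : ℝ)) (0, z.2 - q₀) (0, v) = 0) :
    fderiv ℂ (fun z => transport (β z) 1) z (0, v) = -(α z (0, v) * transport (β z) 1) := by
  have hβ' : ∀ t : I, fderiv ℂ β z (0, v) t
      = (t : ℂ) • fderiv ℂ α (radial q₀ z (t : ℝ)) (0, v) (0, z.2 - q₀)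
        + α (radial q₀ z (t : ℝ)) (0, v) := by
    intro t
    rw [← fderiv_radialCoeff (hα t)]
    have h1 : HasFDerivAt (fun z => β z t) ((evalL 𝔸 t).comp (fderiv ℂ β z)) z :=
      (evalL 𝔸 t).hasFDerivAt.comp z hβ.hasFDerivAt
    have h2 : (fun z => radialCoeff α q₀ (z, (t : ℝ))) =ᶠ[nhds z] fun z => β z t := by
      filter_upwards [hβα] with z' hz'
      exact (hz' t).symm
    rw [h2.fderiv_eq, h1.fderiv]
    rfl
  obtain ⟨w, w0, hw, hdw⟩ := exists_hasDerivAt_transport (β z)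
  have hαc : Continuous fun t : I => α (radial q₀ z (t : ℝ)) := by
    refine continuous_iff_continuousAt.2 fun t => ?_
    refine ContinuousAt.comp (f := fun t : I => radial q₀ z (t : ℝ)) (hα t).continuousAt ?_
    exact ContinuousAt.comp (f := fun t : I => ((t : ℝ) : ℂ))
      (hasDerivAt_radial q₀ z (t : ℝ)).continuousAt
      (Complex.continuous_ofReal.comp continuous_subtype_val).continuousAt
  set m := -ContinuousLinearMap.mul ℂ 𝔸
  -- The expected derivative of the transport along the path: at time t the point moves with
  -- velocity t v, and a frame parallel in that direction changes by -α(t v) W(t).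
  let N : C(I, 𝔸) := ⟨fun t => -((t : ℂ) • (α (radial q₀ z (t : ℝ)) (0, v) * transport (β z) t)),
    ((Complex.continuous_ofReal.comp continuous_subtype_val).smul
      ((hαc.clm_apply continuous_const).mul (transport (β z)).continuous)).neg⟩
  have hN : N = primitive 𝔸 (pointwise I m (fderiv ℂ β z (0, v)) (transport (β z)))
      + primitive 𝔸 (pointwise I m (β z) N) := by
    rw [← map_add]
    have := eq_add_primitive_of_hasDerivAt (g := N)
      (f := fun s : ℝ => -((s : ℂ) • (α (radial q₀ z s) (0, v) * w s)))
      (h := pointwise I m (fderiv ℂ β z (0, v)) (transport (β z)) + pointwise I m (β z) N)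
      (fun t => by simp [N, hw]) (fun t => by
        have h1 : HasDerivAt (fun s : ℝ => (s : ℂ)) 1 (t : ℝ) := Complex.ofRealCLM.hasDerivAt
        have h2 : HasDerivAt (fun s : ℂ => α (radial q₀ z s))
            (fderiv ℂ α (radial q₀ z (t : ℝ)) (0, z.2 - q₀)) (t : ℝ) :=
          (hα t).hasFDerivAt.comp_hasDerivAt ((t : ℝ) : ℂ) (hasDerivAt_radial q₀ z (t : ℝ))
        have h3 : HasDerivAt (fun s : ℝ => α (radial q₀ z s) (0, v))
            (fderiv ℂ α (radial q₀ z (t : ℝ)) (0, z.2 - q₀) (0, v)) (t : ℝ) :=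
          (((ContinuousLinearMap.apply ℂ 𝔸 ((0 : Y), v)).hasFDerivAt.comp_hasDerivAt
            ((t : ℝ) : ℂ) h2).scomp (t : ℝ) h1).congr_deriv (one_smul _ _)
        refine ((h1.smul (h3.mul (hdw t))).neg).congr_deriv ?_
        have hFt := hF t
        rw [flatCurvature] at hFt
        have hβt := hβα.self_of_nhds t
        rw [radialCoeff] at hβt
        simp only [ContinuousMap.add_apply, pointwise_apply, m, Pi.mul_apply, neg_apply,
          ContinuousLinearMap.mul_apply', hβ' t, hβt, hw, N, ContinuousMap.coe_mk]
        set a := fderiv ℂ α (radial q₀ z (t : ℝ)) (0, z.2 - q₀) (0, v)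
        set b := fderiv ℂ α (radial q₀ z (t : ℝ)) (0, v) (0, z.2 - q₀)
        set p := α (radial q₀ z (t : ℝ)) (0, z.2 - q₀)
        set q := α (radial q₀ z (t : ℝ)) (0, v)
        set W := transport (β z) t
        -- Vanishing curvature exchanges the derivative of α(v) along the ray for the derivative of
        -- α(q - q₀) along v, up to the commutator. This is the only place where flatness is used.
        have ha : a = b - (p * q - q * p) := by
          rw [← sub_eq_zero, ← hFt]; abel
        rw [ha]
        simp only [smul_add, smul_sub, sub_mul, add_mul, mul_neg, smul_neg, mul_smul_comm,
          smul_mul_assoc, mul_assoc, one_smul]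
        abel)
    simpa using this
  have hP := fderiv_transport hβ ((0 : Y), v)
  -- The true derivative and `N` solve the same Volterra equation. At t = 1 the radial point is z
  -- itself, and `N` becomes the claimed value.
  have hPN := eq_of_eq_add_primitive hP hN
  have h5 : HasFDerivAt (fun z => transport (β z) 1)
      ((evalL 𝔸 (1 : I)).comp (fderiv ℂ (fun z => transport (β z)) z)) z :=
    (evalL 𝔸 (1 : I)).hasFDerivAt.comp z
      ((contDiff_transport.differentiable (by simp)).differentiableAt.comp z hβ).hasFDerivAt
  rw [h5.fderiv, ContinuousLinearMap.comp_apply, hPN]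
  simp [N, radial]

/-- A connection whose curvature vanishes in the directions of the star-shaped fibres of
`T × S → T` has a frame which is parallel along the fibres. -/
theorem exists_parallel_frame {T : Set Y} {S : Set Q} (hT : IsOpen T) (hS : IsOpen S) {q₀ : Q}
    (hq₀ : ∀ q ∈ S, ∀ t ∈ Icc (0 : ℝ) 1, q₀ + (t : ℂ) • (q - q₀) ∈ S)
    {α : Y × Q → Y × Q →L[ℂ] 𝔸} (hα : ContDiffOn ℂ ∞ α (T ×ˢ S))
    (hF : ∀ z ∈ T ×ˢ S, ∀ v w : Q, flatCurvature α z (0, v) (0, w) = 0) :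
    ∃ V : Y × Q → 𝔸ˣ, ContDiffOn ℂ ∞ (fun z => (V z : 𝔸)) (T ×ˢ S) ∧
      ∀ z ∈ T ×ˢ S, ∀ v : Q,
        fderiv ℂ (fun z => (V z : 𝔸)) z (0, v) = -(α z (0, v) * V z) := by
  have hΩ : IsOpen (T ×ˢ S) := hT.prod hS
  -- Time is treated as a complex variable here, so that the radial coefficient is holomorphic on an
  -- open subset of a complex normed space; only times in [0, 1] are substituted afterwards.
  set O : Set ((Y × Q) × ℂ) := (fun p => radial q₀ p.1 p.2) ⁻¹' (T ×ˢ S)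
  have hO : IsOpen O := hΩ.preimage (contDiff_radial q₀).continuous
  have hΩO : ∀ z ∈ T ×ˢ S, ∀ t : I, (z, ((t : ℝ) : ℂ)) ∈ O :=
    fun z hz t => ⟨hz.1, hq₀ z.2 hz.2 t t.2⟩
  have hc : Continuous fun t : I => ((t : ℝ) : ℂ) := by fun_prop
  have hh : ContDiffOn ℂ ∞ (radialCoeff α q₀) O :=
    (hα.comp (contDiff_radial q₀).contDiffOn fun p hp => hp).clm_apply (by fun_prop)
  obtain ⟨β, hβ⟩ := exists_curry hh.continuousOn hc hΩO
  have hβs : ContDiffOn ℂ ∞ β (T ×ˢ S) := contDiffOn_of_prod hO hc hΩ hΩO hh hβ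
  refine ⟨fun z => transportUnit (β z) 1, ?_, fun z hz v => ?_⟩
  · exact (evalL 𝔸 (1 : I)).contDiff.comp_contDiffOn (contDiff_transport.comp_contDiffOn hβs)
  · refine fderiv_transport_radial ((hβs.contDiffAt (hΩ.mem_nhds hz)).differentiableAt (by simp))
      ?_ (fun t => ?_) v fun t => hF _ (hΩO z hz t) _ _
    · filter_upwards [hΩ.mem_nhds hz] with z' hz'
      exact hβ z' hz'
    · exact (hα.contDiffAt (hΩ.mem_nhds (hΩO z hz t))).differentiableAt (by simp)

end Radial

end Volterra

/-! ### Pull-backs and gauge transformations on normed spaces -/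

namespace Volterra

section Flat

variable {𝔸 : Type*} [NormedRing 𝔸] [NormedAlgebra ℂ 𝔸]
  {Z E : Type*} [NormedAddCommGroup Z] [NormedSpace ℂ Z] [NormedAddCommGroup E] [NormedSpace ℂ E]

theorem flatCurvature_congr {α α' : Z → Z →L[ℂ] 𝔸} {z : Z} (h : α =ᶠ[nhds z] α') (v w : Z) :
    flatCurvature α z v w = flatCurvature α' z v w := by
  simp only [flatCurvature, h.fderiv_eq, h.eq_of_nhds]

theorem fderiv_fderiv_symm {F : Type*} [NormedAddCommGroup F] [NormedSpace ℂ F] {φ : Z → F} {z : Z}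
    (hφ : ContDiffAt ℂ ∞ φ z) (v w : Z) :
    fderiv ℂ (fderiv ℂ φ) z v w = fderiv ℂ (fderiv ℂ φ) z w v :=
  (hφ.isSymmSndFDerivAt (by
    rw [minSmoothness_of_isRCLikeNormedField]; exact WithTop.coe_le_coe.2 (le_top : (2 : ℕ∞) ≤ ⊤))).eq v w

theorem contDiffAt_fderiv {F : Type*} [NormedAddCommGroup F] [NormedSpace ℂ F] {φ : Z → F} {z : Z}
    (hφ : ContDiffAt ℂ ∞ φ z) : ContDiffAt ℂ ∞ (fderiv ℂ φ) z :=
  hφ.fderiv_right (by simp)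

theorem contDiffAt_flatPull {β : E → E →L[ℂ] 𝔸} {φ : Z → E} {z : Z} (hφ : ContDiffAt ℂ ∞ φ z)
    (hβ : ContDiffAt ℂ ∞ β (φ z)) :
    ContDiffAt ℂ ∞ (fun y => (β (φ y)).comp (fderiv ℂ φ y)) z :=
  (hβ.comp z hφ).clm_comp (contDiffAt_fderiv hφ)

/-- The terms with the second derivative of φ cancel because that derivative is symmetric; the rest
is the chain rule. -/
theorem flatCurvature_flatPull {β : E → E →L[ℂ] 𝔸} {φ : Z → E} {z : Z}
    (hφ : ContDiffAt ℂ ∞ φ z) (hβ : ContDiffAt ℂ ∞ β (φ z)) (v w : Z) :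
    flatCurvature (fun y => (β (φ y)).comp (fderiv ℂ φ y)) z v w
      = flatCurvature β (φ z) (fderiv ℂ φ z v) (fderiv ℂ φ z w) := by
  have h1 : HasFDerivAt (fun y => β (φ y)) _ z :=
    (hβ.differentiableAt (by simp)).hasFDerivAt.comp z (hφ.differentiableAt (by simp)).hasFDerivAt
  have h2 := ((contDiffAt_fderiv hφ).differentiableAt (by simp)).hasFDerivAt
  have h3 := (h1.clm_comp h2).fderiv
  have h4 := fderiv_fderiv_symm hφ v w
  simp only [flatCurvature, h3]
  simp [h4]

section Gauge

variable [CompleteSpace 𝔸]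

/-- The linear map `v ↦ u⁻¹ (d(v) + a(v) u)`. -/
def gaugeForm (u : 𝔸ˣ) (d a : Z →L[ℂ] 𝔸) : Z →L[ℂ] 𝔸 :=
  (ContinuousLinearMap.mul ℂ 𝔸 (u⁻¹ : 𝔸ˣ)).comp
    (d + ((ContinuousLinearMap.mul ℂ 𝔸).flip u).comp a)

/-- The gauge transform `u⁻¹ du + u⁻¹ α u`. -/
def flatGauge (α : Z → Z →L[ℂ] 𝔸) (u : Z → 𝔸ˣ) (y : Z) : Z →L[ℂ] 𝔸 :=
  gaugeForm (u y) (fderiv ℂ (fun y => (u y : 𝔸)) y) (α y)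

omit [CompleteSpace 𝔸] in
theorem flatGauge_apply (α : Z → Z →L[ℂ] 𝔸) (u : Z → 𝔸ˣ) (y v : Z) :
    flatGauge α u y v = ((u y)⁻¹ : 𝔸ˣ) * (fderiv ℂ (fun y => (u y : 𝔸)) y v + α y v * u y) := rfl

theorem contDiffAt_units_inv {u : Z → 𝔸ˣ} {z : Z} (hu : ContDiffAt ℂ ∞ (fun y => (u y : 𝔸)) z) :
    ContDiffAt ℂ ∞ (fun y => (((u y)⁻¹ : 𝔸ˣ) : 𝔸)) z := by
  have h := (contDiffAt_ringInverse (n := ∞) ℂ (u z)).comp z hu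
  refine h.congr_of_eventuallyEq (Filter.Eventually.of_forall fun y => ?_)
  simp

theorem fderiv_units_inv {u : Z → 𝔸ˣ} {z : Z} (hu : DifferentiableAt ℂ (fun y => (u y : 𝔸)) z)
    (v : Z) : fderiv ℂ (fun y => (((u y)⁻¹ : 𝔸ˣ) : 𝔸)) z v
      = -(((u z)⁻¹ : 𝔸ˣ) * fderiv ℂ (fun y => (u y : 𝔸)) z v * ((u z)⁻¹ : 𝔸ˣ)) := by
  have h := (hasFDerivAt_ringInverse (𝕜 := ℂ) (u z)).comp z hu.hasFDerivAt
  have h2 : (fun y => (((u y)⁻¹ : 𝔸ˣ) : 𝔸)) = Ring.inverse ∘ fun y => (u y : 𝔸) := by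
    ext y; simp
  rw [h2, h.fderiv]
  rfl

set_option synthInstance.maxHeartbeats 400000 in
theorem contDiffAt_flatGauge {α : Z → Z →L[ℂ] 𝔸} {u : Z → 𝔸ˣ} {z : Z} (hα : ContDiffAt ℂ ∞ α z)
    (hu : ContDiffAt ℂ ∞ (fun y => (u y : 𝔸)) z) : ContDiffAt ℂ ∞ (flatGauge α u) z :=
  (contDiffAt_const.clm_apply (contDiffAt_units_inv hu)).clm_comp
    ((contDiffAt_fderiv hu).add ((contDiffAt_const.clm_apply hu).clm_comp hα))

theorem fderiv_flatGauge {α : Z → Z →L[ℂ] 𝔸} {u : Z → 𝔸ˣ} {z : Z} (hα : ContDiffAt ℂ ∞ α z)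
    (hu : ContDiffAt ℂ ∞ (fun y => (u y : 𝔸)) z) (v w : Z) :
    fderiv ℂ (flatGauge α u) z v w =
      -(((u z)⁻¹ : 𝔸ˣ) * fderiv ℂ (fun y => (u y : 𝔸)) z v * ((u z)⁻¹ : 𝔸ˣ))
          * (fderiv ℂ (fun y => (u y : 𝔸)) z w + α z w * u z)
        + ((u z)⁻¹ : 𝔸ˣ) * (fderiv ℂ (fderiv ℂ (fun y => (u y : 𝔸))) z v w
          + (fderiv ℂ α z v w * u z + α z w * fderiv ℂ (fun y => (u y : 𝔸)) z v)) := by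
  have hd := (contDiffAt_flatGauge hα hu).differentiableAt (by simp)
  have hi := ((contDiffAt_units_inv hu).differentiableAt (by simp)).hasFDerivAt
  have h0 := (hu.differentiableAt (by simp)).hasFDerivAt
  have h1 := ((contDiffAt_fderiv hu).differentiableAt (by simp)).hasFDerivAt
  have h2 := (hα.differentiableAt (by simp)).hasFDerivAt
  have e1 : ∀ {β : Z → Z →L[ℂ] 𝔸} {β' : Z →L[ℂ] Z →L[ℂ] 𝔸}, HasFDerivAt β β' z →
      HasFDerivAt (fun y => β y w) (β'.flip w) z := fun h => by
    have := h.clm_apply (hasFDerivAt_const w z)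
    refine this.congr_fderiv ?_
    ext x
    simp
  have h3 := hi.mul' ((e1 h1).add ((e1 h2).mul' h0))
  have h4 := (e1 hd.hasFDerivAt).unique h3
  have h5 := congrArg (fun L : Z →L[ℂ] 𝔸 => L v) h4
  simp only [ContinuousLinearMap.flip_apply] at h5
  rw [h5]
  simp [fderiv_units_inv (hu.differentiableAt (by simp)), mul_add, mul_assoc]
  abel

/-- The second derivatives of u cancel by symmetry, and the terms quadratic in u⁻¹ du cancel against
those in the commutator. -/
theorem flatCurvature_flatGauge {α : Z → Z →L[ℂ] 𝔸} {u : Z → 𝔸ˣ} {z : Z}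
    (hα : ContDiffAt ℂ ∞ α z) (hu : ContDiffAt ℂ ∞ (fun y => (u y : 𝔸)) z) (v w : Z) :
    flatCurvature (flatGauge α u) z v w = ((u z)⁻¹ : 𝔸ˣ) * flatCurvature α z v w * u z := by
  simp only [flatCurvature, fderiv_flatGauge hα hu, flatGauge_apply, fderiv_fderiv_symm hu w v]
  have h : ∀ a : 𝔸, (u z : 𝔸) * (((u z)⁻¹ : 𝔸ˣ) * a) = a := fun a => by
    rw [← mul_assoc, Units.mul_inv, one_mul]
  simp only [mul_add, add_mul, mul_sub, sub_mul, mul_assoc, neg_mul, h]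
  abel

end Gauge

end Flat

end Volterra

/-! ### Pull-backs and gauge transformations on manifolds -/

namespace HalfFlat

open Volterra

variable {E : Type*} [NormedAddCommGroup E] [NormedSpace ℂ E]
  {H : Type*} [TopologicalSpace H] {I : ModelWithCorners ℂ E H}
  {N : Type*} [TopologicalSpace N] [ChartedSpace H N]
  {Z : Type*} [NormedAddCommGroup Z] [NormedSpace ℂ Z] {r : ℕ}

/-- The pull-back of a 1-form under a map `f` from a normed space to a manifold. -/
def pullForm (A : Potential I N r) (f : Z → N) (y : Z) : Z →L[ℂ] Gl r :=
  (A (f y)).comp (mfderiv 𝓘(ℂ, Z) I f y)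

/-- All tangent spaces are definitionally the model space `E`, so a vector can be kept while its
base point is replaced by an equal one. Dependent rewriting is avoided in this way throughout. -/
theorem potential_apply_congr (A : Potential I N r) {p q : N} (h : p = q) (v : E) :
    A p v = A q v := by
  subst h; rfl

theorem pullForm_congr (A : Potential I N r) {f g : Z → N} {y : Z} (h : f =ᶠ[nhds y] g) :
    pullForm A f y = pullForm A g y := by
  ext v : 1
  have h1 := congrArg (fun L : Z →L[ℂ] E => L v) (h.mfderiv_eq (I := 𝓘(ℂ, Z)) (I' := I))
  exact (congrArg (fun e : E => A (f y) e) h1).trans (potential_apply_congr A h.eq_of_nhds _)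

variable [I.Boundaryless] [IsManifold I ∞ N]

theorem mdifferentiableAt_extChartAt_symm {x : N} {y : E} (hy : y ∈ (extChartAt I x).target) :
    MDifferentiableAt 𝓘(ℂ, E) I (extChartAt I x).symm y :=
  ((contMDiffOn_extChartAt_symm (n := ∞) x).contMDiffAt
    ((isOpen_extChartAt_target x).mem_nhds hy)).mdifferentiableAt (by simp)

theorem mfderiv_extChartAt_symm_self (x : N) (v : E) :
    mfderiv 𝓘(ℂ, E) I (extChartAt I x).symm (extChartAt I x x) v = v := by
  have h := mfderivWithin_range_extChartAt_symm (I := I) (x := x)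
  rw [I.range_eq_univ, mfderivWithin_univ] at h
  rw [h]
  rfl

theorem inChart_self_apply (A : Potential I N r) (x : N) (v : E) :
    inChart A x (extChartAt I x x) v = A x v := by
  have h1 : inChart A x (extChartAt I x x) v = A ((extChartAt I x).symm (extChartAt I x x))
    (mfderiv 𝓘(ℂ, E) I (extChartAt I x).symm (extChartAt I x x) v) := rfl
  rw [h1, mfderiv_extChartAt_symm_self]
  exact potential_apply_congr A (extChartAt_to_inv x) v

/-- The derivative of the inverse chart at the centre of the chart is the identity, so the
commutator term of the coefficient form is that of `A` itself. -/
theorem curvature_eq_flatCurvature (A : Potential I N r) (x : N) (v w : E) :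
    curvature A x v w = flatCurvature (inChart A x) (extChartAt I x x) v w := by
  simp only [flatCurvature, inChart_self_apply]
  rfl

theorem contDiffAt_extChartAt_comp {f : Z → N} {z : Z} (hf : ContMDiffAt 𝓘(ℂ, Z) I ∞ f z) :
    ContDiffAt ℂ ∞ (fun y => extChartAt I (f z) (f y)) z :=
  contMDiffAt_iff_contDiffAt.1 (contMDiffAt_extChartAt.comp z hf)

/-- Near z the map f factors through the single chart at f z. Questions about `A` thereby become
questions about one coefficient form on a normed space. -/
theorem pullForm_eventuallyEq (A : Potential I N r) {f : Z → N} {z : Z}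
    (hf : ContMDiffAt 𝓘(ℂ, Z) I ∞ f z) :
    pullForm A f =ᶠ[nhds z] fun y => (inChart A (f z) (extChartAt I (f z) (f y))).comp
      (fderiv ℂ (fun y => extChartAt I (f z) (f y)) y) := by
  have hs : ∀ᶠ y in nhds z, f y ∈ (extChartAt I (f z)).source :=
    hf.continuousAt.eventually (extChartAt_source_mem_nhds (I := I) (f z))
  have hd : ∀ᶠ y in nhds z, DifferentiableAt ℂ (fun y => extChartAt I (f z) (f y)) y := by
    filter_upwards [((contDiffAt_extChartAt_comp hf).of_le (m := 1) (by simp)).eventually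
      (by simp)] with y hy
    exact hy.differentiableAt (by simp)
  filter_upwards [hs.eventually_nhds, hd] with y hy hdy
  have h1 : f =ᶠ[nhds y] fun y => (extChartAt I (f z)).symm (extChartAt I (f z) (f y)) := by
    filter_upwards [hy] with y' hy'
    exact ((extChartAt I (f z)).left_inv hy').symm
  rw [pullForm_congr A h1]
  have h2 := mfderiv_comp (I := 𝓘(ℂ, Z)) (I' := 𝓘(ℂ, E)) (I'' := I) y
    (g := (extChartAt I (f z)).symm) (f := fun y => extChartAt I (f z) (f y))
    (mdifferentiableAt_extChartAt_symm ((extChartAt I (f z)).map_source hy.self_of_nhds))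
    hdy.mdifferentiableAt
  ext v : 1
  have h3 := congrArg (fun L : Z →L[ℂ] E => L v) h2
  rw [mfderiv_eq_fderiv] at h3
  exact congrArg (fun e : E => A ((extChartAt I (f z)).symm (extChartAt I (f z) (f y))) e) h3

theorem IsHolomorphic.contDiffAt_inChart {A : Potential I N r} (hA : IsHolomorphic A) {x : N}
    {y : E} (hy : y ∈ (extChartAt I x).target) : ContDiffAt ℂ ∞ (inChart A x) y :=
  (hA x).contDiffAt ((isOpen_extChartAt_target x).mem_nhds hy)

theorem IsHolomorphic.contDiffAt_pullForm {A : Potential I N r} (hA : IsHolomorphic A) {f : Z → N}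
    {z : Z} (hf : ContMDiffAt 𝓘(ℂ, Z) I ∞ f z) : ContDiffAt ℂ ∞ (pullForm A f) z :=
  (contDiffAt_flatPull (contDiffAt_extChartAt_comp hf)
    (hA.contDiffAt_inChart (mem_extChartAt_target (f z)))).congr_of_eventuallyEq
    (pullForm_eventuallyEq A hf)

theorem fderiv_extChartAt_comp {f : Z → N} {z : Z} (hf : MDifferentiableAt 𝓘(ℂ, Z) I f z) (v : Z) :
    fderiv ℂ (fun y => extChartAt I (f z) (f y)) z v = mfderiv 𝓘(ℂ, Z) I f z v := by
  rw [← mfderiv_eq_fderiv]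
  have h := mfderiv_comp (I := 𝓘(ℂ, Z)) (I' := I) (I'' := 𝓘(ℂ, E)) z
    (g := extChartAt I (f z)) (f := f) (mdifferentiableAt_extChartAt (mem_chart_source H (f z))) hf
  have h1 := congrArg (fun L : Z →L[ℂ] E => L v) h
  refine h1.trans ?_
  rw [mfderiv_extChartAt_self]
  rfl

/-- Curvature is natural under pull-back. -/
theorem IsHolomorphic.flatCurvature_pullForm {A : Potential I N r} (hA : IsHolomorphic A)
    {f : Z → N} {z : Z} (hf : ContMDiffAt 𝓘(ℂ, Z) I ∞ f z) (v w : Z) :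
    flatCurvature (pullForm A f) z v w
      = curvature A (f z) (mfderiv 𝓘(ℂ, Z) I f z v) (mfderiv 𝓘(ℂ, Z) I f z w) := by
  rw [flatCurvature_congr (pullForm_eventuallyEq A hf),
    flatCurvature_flatPull (contDiffAt_extChartAt_comp hf)
      (hA.contDiffAt_inChart (mem_extChartAt_target (f z))),
    fderiv_extChartAt_comp (hf.mdifferentiableAt (by simp)),
    fderiv_extChartAt_comp (hf.mdifferentiableAt (by simp))]
  exact (curvature_eq_flatCurvature A _ _ _).symm

/-- The gauge transform `U⁻¹ dU + U⁻¹ A U`. -/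
def gauge (A : Potential I N r) (U : N → (Gl r)ˣ) : Potential I N r := fun x =>
  gaugeForm (𝔸 := Gl r) (Z := E) (U x) (mvfderiv I (fun y => (U y : Gl r)) x) (A x)

theorem gauge_apply (A : Potential I N r) (U : N → (Gl r)ˣ) (x : N) (v : TangentSpace I x) :
    gauge A U x v = ((U x)⁻¹ : (Gl r)ˣ) * (mvfderiv I (fun y => (U y : Gl r)) x v + A x v * U x) :=
  rfl

theorem gaugeEquivalent_iff {A A' : Potential I N r} :
    GaugeEquivalent A A' ↔ ∃ U : N → (Gl r)ˣ,
      ContMDiff I 𝓘(ℂ, Gl r) ∞ (fun x => (U x : Gl r)) ∧ A' = gauge A U := by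
  refine exists_congr fun U => and_congr_right fun _ => ⟨fun h => ?_, fun h x v => ?_⟩
  · funext x
    ext v : 1
    rw [h x v, gauge_apply, mul_add, mul_assoc _ (A x v)]
  · rw [h, gauge_apply, mul_add, mul_assoc _ (A x v)]

theorem pullForm_gauge (A : Potential I N r) {U : N → (Gl r)ˣ}
    (hU : ContMDiff I 𝓘(ℂ, Gl r) ∞ (fun x => (U x : Gl r))) {f : Z → N} {y : Z}
    (hf : MDifferentiableAt 𝓘(ℂ, Z) I f y) :
    pullForm (gauge A U) f y = flatGauge (pullForm A f) (fun y => U (f y)) y := by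
  have h := mfderiv_comp y (g := fun x => (U x : Gl r)) ((hU (f y)).mdifferentiableAt (by simp)) hf
  have h1 : fderiv ℂ (fun y => (U (f y) : Gl r)) y
      = (mvfderiv I (fun x => (U x : Gl r)) (f y)).comp (mfderiv 𝓘(ℂ, Z) I f y) := by
    rw [← mfderiv_eq_fderiv]
    exact h
  ext v : 1
  rw [flatGauge_apply, h1]
  rfl

theorem IsHolomorphic.gauge {A : Potential I N r} (hA : IsHolomorphic A) {U : N → (Gl r)ˣ}
    (hU : ContMDiff I 𝓘(ℂ, Gl r) ∞ (fun x => (U x : Gl r))) : IsHolomorphic (gauge A U) := by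
  intro x
  have hs := contMDiffOn_extChartAt_symm (I := I) (n := ∞) x
  have h1 : ContDiffOn ℂ ∞ (flatGauge (inChart A x) fun y => U ((extChartAt I x).symm y))
      (extChartAt I x).target := fun y hy => by
    refine (contDiffAt_flatGauge (hA.contDiffAt_inChart hy) ?_).contDiffWithinAt
    exact contMDiffAt_iff_contDiffAt.1 ((hU _).comp y
      (hs.contMDiffAt ((isOpen_extChartAt_target x).mem_nhds hy)))
  exact h1.congr fun y hy => pullForm_gauge A hU (mdifferentiableAt_extChartAt_symm hy)

theorem IsHolomorphic.curvature_gauge {A : Potential I N r} (hA : IsHolomorphic A)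
    {U : N → (Gl r)ˣ} (hU : ContMDiff I 𝓘(ℂ, Gl r) ∞ (fun x => (U x : Gl r))) (x : N)
    (v w : E) :
    curvature (HalfFlat.gauge A U) x v w = ((U x)⁻¹ : (Gl r)ˣ) * curvature A x v w * U x := by
  have hx := mem_extChartAt_target (I := I) x
  have hs := (contMDiffOn_extChartAt_symm (I := I) (n := ∞) x).contMDiffAt
    ((isOpen_extChartAt_target x).mem_nhds hx)
  have h1 : inChart (HalfFlat.gauge A U) x =ᶠ[nhds (extChartAt I x x)]
      flatGauge (inChart A x) fun y => U ((extChartAt I x).symm y) := by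
    filter_upwards [(isOpen_extChartAt_target x).mem_nhds hx] with y hy
    exact pullForm_gauge A hU (mdifferentiableAt_extChartAt_symm hy)
  rw [curvature_eq_flatCurvature, curvature_eq_flatCurvature, flatCurvature_congr h1,
    flatCurvature_flatGauge (hA.contDiffAt_inChart hx)
      (contMDiffAt_iff_contDiffAt.1 ((hU _).comp _ hs)), extChartAt_to_inv]

end HalfFlat

/-! ### Locally constant functions -/

theorem IsPreconnected.eq_of_eventually_eq {X F : Type*} [TopologicalSpace X] {W : Set X}
    (hW : IsPreconnected W) {h : X → F} (hloc : ∀ g ∈ W, ∀ᶠ g' in nhds g, h g' = h g) {g g' : X}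
    (hg : g ∈ W) (hg' : g' ∈ W) : h g = h g' := by
  -- With the discrete topology on the target, local constancy becomes continuity.
  let _ : TopologicalSpace F := ⊥
  have : DiscreteTopology F := ⟨rfl⟩
  refine hW.constant (f := h) (fun x hx => ContinuousAt.continuousWithinAt ?_) hg hg'
  rw [ContinuousAt, nhds_discrete F, Filter.tendsto_pure]
  exact hloc x hx

section LocallyConstant

variable {E : Type*} [NormedAddCommGroup E] [NormedSpace ℂ E]
  {H : Type*} [TopologicalSpace H] {I : ModelWithCorners ℂ E H}
  {N : Type*} [TopologicalSpace N] [ChartedSpace H N] {F : Type*} [NormedAddCommGroup F]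
  [NormedSpace ℂ F]

theorem eventually_eq_of_fderiv_eq_zero {h : E → F} {z : E}
    (hd : ∀ᶠ y in nhds z, DifferentiableAt ℂ h y ∧ fderiv ℂ h y = 0) :
    ∀ᶠ y in nhds z, h y = h z := by
  obtain ⟨ε, hε, hball⟩ := Metric.eventually_nhds_iff_ball.1 hd
  filter_upwards [Metric.ball_mem_nhds z hε] with y hy
  exact Metric.isOpen_ball.is_const_of_fderiv_eq_zero (𝕜 := ℂ)
    (convex_ball z ε).isPreconnected
    (fun x hx => (hball x hx).1.differentiableWithinAt) (fun x hx => (hball x hx).2) hy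
    (Metric.mem_ball_self hε)

theorem eventually_eq_of_mfderiv_eq_zero [I.Boundaryless] [IsManifold I ∞ N] {h : N → F} {g : N}
    (hd : ∀ᶠ g' in nhds g, MDifferentiableAt I 𝓘(ℂ, F) h g' ∧ mfderiv I 𝓘(ℂ, F) h g' = 0) :
    ∀ᶠ g' in nhds g, h g' = h g := by
  have hx := mem_extChartAt_target (I := I) g
  have hT := (isOpen_extChartAt_target (I := I) g).mem_nhds hx
  have hc : Filter.Tendsto (extChartAt I g).symm (nhds (extChartAt I g g)) (nhds g) := by
    have := continuousAt_extChartAt_symm (I := I) g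
    rwa [ContinuousAt, extChartAt_to_inv] at this
  have h1 : ∀ᶠ y in nhds (extChartAt I g g),
      h ((extChartAt I g).symm y) = h ((extChartAt I g).symm (extChartAt I g g)) := by
    refine eventually_eq_of_fderiv_eq_zero ?_
    filter_upwards [hc.eventually hd, hT] with y hy hyT
    have hs := HalfFlat.mdifferentiableAt_extChartAt_symm (I := I) hyT
    refine ⟨(hy.1.comp y hs).differentiableAt, ?_⟩
    rw [← mfderiv_eq_fderiv]
    refine (mfderiv_comp y hy.1 hs).trans ?_
    rw [hy.2]
    exact ContinuousLinearMap.zero_comp _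
  rw [extChartAt_to_inv] at h1
  filter_upwards [(continuousAt_extChartAt (I := I) g).eventually h1,
    extChartAt_source_mem_nhds (I := I) g] with g' hg' hs
  rwa [(extChartAt I g).left_inv hs] at hg'

end LocallyConstant

/-! ### Holomorphic maps to and from `SL(2, ℂ)` -/

namespace SLTwo

theorem chartA_mem_maximalAtlas :
    chartA ∈ IsManifold.maximalAtlas 𝓘(ℂ, ℂ × ℂ × ℂ) ∞ SL2C :=
  IsManifold.subset_maximalAtlas (Or.inl rfl)

theorem chartB_mem_maximalAtlas :
    chartB ∈ IsManifold.maximalAtlas 𝓘(ℂ, ℂ × ℂ × ℂ) ∞ SL2C :=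
  IsManifold.subset_maximalAtlas (Or.inr rfl)

theorem contMDiff_entry (i j : Fin 2) :
    ContMDiff 𝓘(ℂ, ℂ × ℂ × ℂ) 𝓘(ℂ, ℂ) ∞ fun U : SL2C => U.1 i j := by
  intro U
  by_cases h : U.1 0 0 = 0
  · have hc : U.1 1 0 ≠ 0 := fun hc => by simpa [h, hc] using det_eq U
    have h1 := contMDiffAt_of_mem_maximalAtlas chartB_mem_maximalAtlas (x := U) hc
    have h2 : ContDiffAt ℂ ∞ (fun q : ℂ × ℂ × ℂ =>
        (!![q.1, (q.1 * q.2.2 - 1) / q.2.1; q.2.1, q.2.2] : Matrix (Fin 2) (Fin 2) ℂ) i j)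
        (chartB U) := by
      fin_cases i <;> fin_cases j <;> simp
      · fun_prop
      · exact ContDiffAt.div (by fun_prop) (by fun_prop) hc
      · fun_prop
      · fun_prop
    refine (h2.comp_contMDiffAt h1).congr_of_eventuallyEq ?_
    filter_upwards [chartB.open_source.mem_nhds hc] with V hV
    rw [Function.comp_apply, ← invB_val (chartB.map_source hV)]
    exact congrArg (fun W : SL2C => W.1 i j) (chartB.left_inv hV).symm
  · have h1 := contMDiffAt_of_mem_maximalAtlas chartA_mem_maximalAtlas (x := U) h
    have h2 : ContDiffAt ℂ ∞ (fun q : ℂ × ℂ × ℂ =>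
        (!![q.1, q.2.1; q.2.2, (1 + q.2.1 * q.2.2) / q.1] : Matrix (Fin 2) (Fin 2) ℂ) i j)
        (chartA U) := by
      fin_cases i <;> fin_cases j <;> simp
      · fun_prop
      · fun_prop
      · fun_prop
      · exact ContDiffAt.div (by fun_prop) (by fun_prop) h
    refine (h2.comp_contMDiffAt h1).congr_of_eventuallyEq ?_
    filter_upwards [chartA.open_source.mem_nhds h] with V hV
    rw [Function.comp_apply, ← invA_val (chartA.map_source hV)]
    exact congrArg (fun W : SL2C => W.1 i j) (chartA.left_inv hV).symm

section

variable {E : Type*} [NormedAddCommGroup E] [NormedSpace ℂ E]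
  {H : Type*} [TopologicalSpace H] {J : ModelWithCorners ℂ E H}
  {N : Type*} [TopologicalSpace N] [ChartedSpace H N]

/-- Since a and c cannot both vanish, one of the two charts is available near f x, and its
coordinates are entries. -/
theorem contMDiffAt_of_entries {f : N → SL2C} {x : N}
    (h : ∀ i j, ContMDiffAt J 𝓘(ℂ, ℂ) ∞ (fun y => (f y).1 i j) x) :
    ContMDiffAt J 𝓘(ℂ, ℂ × ℂ × ℂ) ∞ f x := by
  by_cases h0 : (f x).1 0 0 = 0
  · have hc : (f x).1 1 0 ≠ 0 := fun hc => by simpa [h0, hc] using det_eq (f x)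
    have h1 : ContMDiffAt J 𝓘(ℂ, ℂ × ℂ × ℂ) ∞ (fun y => chartB (f y)) x :=
      (h 0 0).prodMk_space ((h 1 0).prodMk_space (h 1 1))
    have h2 := contMDiffAt_symm_of_mem_maximalAtlas chartB_mem_maximalAtlas
      (x := chartB (f x)) (chartB.map_source hc)
    refine (h2.comp x h1).congr_of_eventuallyEq ?_
    filter_upwards [(h 1 0).continuousAt.eventually_ne hc] with y hy
    exact (chartB.left_inv hy).symm
  · have h1 : ContMDiffAt J 𝓘(ℂ, ℂ × ℂ × ℂ) ∞ (fun y => chartA (f y)) x :=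
      (h 0 0).prodMk_space ((h 0 1).prodMk_space (h 1 0))
    have h2 := contMDiffAt_symm_of_mem_maximalAtlas chartA_mem_maximalAtlas
      (x := chartA (f x)) (chartA.map_source h0)
    refine (h2.comp x h1).congr_of_eventuallyEq ?_
    filter_upwards [(h 0 0).continuousAt.eventually_ne h0] with y hy
    exact (chartA.left_inv hy).symm

end

theorem contMDiff_mul_left (k : SL2C) :
    ContMDiff 𝓘(ℂ, ℂ × ℂ × ℂ) 𝓘(ℂ, ℂ × ℂ × ℂ) ∞ fun U : SL2C => k * U := by
  intro U
  refine contMDiffAt_of_entries fun i j => ?_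
  have h : (fun V : SL2C => (k * V).1 i j)
      = fun V : SL2C => k.1 i 0 * V.1 0 j + k.1 i 1 * V.1 1 j := by
    funext V
    change (k.1 * V.1) i j = _
    rw [Matrix.mul_apply, Fin.sum_univ_two]
  rw [h]
  have h2 : ContDiff ℂ ∞ fun q : ℂ × ℂ => k.1 i 0 * q.1 + k.1 i 1 * q.2 := by fun_prop
  exact h2.contDiffAt.comp_contMDiffAt
    (((contMDiff_entry 0 j) U).prodMk_space ((contMDiff_entry 1 j) U))

/-! ### Slit domains -/

/-- The domain `{U | (k U)₀₀ ∉ (-∞, 0]}` of `SL(2, ℂ)`. -/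
def slitDomain (k : SL2C) : Set SL2C := {U | (k * U).1 0 0 ∈ Complex.slitPlane}

theorem mem_slitDomain_iff {k U : SL2C} :
    U ∈ slitDomain k ↔ k.1 0 0 * U.1 0 0 + k.1 0 1 * U.1 1 0 ∈ Complex.slitPlane := by
  have h : (k * U).1 0 0 = k.1 0 0 * U.1 0 0 + k.1 0 1 * U.1 1 0 := by
    change (k.1 * U.1) 0 0 = _
    rw [Matrix.mul_apply, Fin.sum_univ_two]
  rw [← h]
  rfl

/-- Up to sign this is the determinant of the first rows of k and k', so it is nonzero exactly when
the linear forms in (a, c) that define the two slit domains are independent. -/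
theorem mul_inv_zero_one (k k' : SL2C) :
    (k' * k⁻¹).1 0 1 = k'.1 0 1 * k.1 0 0 - k'.1 0 0 * k.1 0 1 := by
  change (k'.1 * k.1.adjugate) 0 1 = _
  rw [Matrix.mul_apply, Fin.sum_univ_two, Matrix.adjugate_fin_two]
  simp
  ring

variable (k : SL2C)

/-- The image of `slitDomain k` in coordinates. -/
def slitTarget : Set (ℂ × ℂ × ℂ) := {q | q.1 ∈ Complex.slitPlane}

/-- The coordinates `(a, b, c)` of `k U`. -/
def slitCoord (U : SL2C) : ℂ × ℂ × ℂ := chartA (k * U)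

/-- The parametrisation of `slitDomain k`. -/
def slitParam (q : ℂ × ℂ × ℂ) : SL2C := k⁻¹ * chartA.symm q

theorem isOpen_slitDomain : IsOpen (slitDomain k) :=
  Complex.isOpen_slitPlane.preimage
    ((continuous_entry 0 0).comp (contMDiff_mul_left k).continuous)

theorem isOpen_slitTarget : IsOpen slitTarget :=
  Complex.isOpen_slitPlane.preimage continuous_fst

theorem slitTarget_subset : slitTarget ⊆ chartA.target :=
  fun _ hq => Complex.slitPlane_ne_zero hq

theorem slitCoord_mem {U : SL2C} (hU : U ∈ slitDomain k) : slitCoord k U ∈ slitTarget := hU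

theorem slitParam_slitCoord {U : SL2C} (hU : U ∈ slitDomain k) :
    slitParam k (slitCoord k U) = U := by
  rw [slitParam, slitCoord, chartA.left_inv (Complex.slitPlane_ne_zero hU), inv_mul_cancel_left]

theorem contMDiffAt_slitCoord {U : SL2C} (hU : U ∈ slitDomain k) :
    ContMDiffAt 𝓘(ℂ, ℂ × ℂ × ℂ) 𝓘(ℂ, ℂ × ℂ × ℂ) ∞ (slitCoord k) U :=
  ContMDiffAt.comp U (contMDiffAt_of_mem_maximalAtlas chartA_mem_maximalAtlas
    (Complex.slitPlane_ne_zero hU)) (contMDiff_mul_left k U)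

theorem contMDiffAt_slitParam {q : ℂ × ℂ × ℂ} (hq : q ∈ slitTarget) :
    ContMDiffAt 𝓘(ℂ, ℂ × ℂ × ℂ) 𝓘(ℂ, ℂ × ℂ × ℂ) ∞ (slitParam k) q :=
  ContMDiffAt.comp q (contMDiff_mul_left k⁻¹ _)
    (contMDiffAt_symm_of_mem_maximalAtlas chartA_mem_maximalAtlas (slitTarget_subset hq))

/-- The slit plane is star-shaped about 1 and the other two coordinates are unrestricted. -/
theorem slitTarget_star (q : ℂ × ℂ × ℂ) (hq : q ∈ slitTarget) (t : ℝ) (ht : t ∈ Icc (0 : ℝ) 1) :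
    ((1, 0, 0) : ℂ × ℂ × ℂ) + (t : ℂ) • (q - (1, 0, 0)) ∈ slitTarget := by
  have := Complex.starConvex_one_slitPlane.add_smul_sub_mem hq ht.1 ht.2
  simpa [slitTarget] using this

theorem isPreconnected_slitPlane : IsPreconnected Complex.slitPlane :=
  (Complex.starConvex_one_slitPlane.isPathConnected
    Complex.one_mem_slitPlane).isConnected.isPreconnected

theorem isPreconnected_slitDomain_inter_one (m : SL2C) (hm : m.1 0 1 ≠ 0 ∨ m = 1) :
    IsPreconnected {U : SL2C | U.1 0 0 ∈ Complex.slitPlane ∧ (m * U).1 0 0 ∈ Complex.slitPlane} := by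
  have hmul : ∀ U : SL2C, (m * U).1 0 0 = m.1 0 0 * U.1 0 0 + m.1 0 1 * U.1 1 0 := fun U => by
    change (m.1 * U.1) 0 0 = _
    rw [Matrix.mul_apply, Fin.sum_univ_two]
  have hcont : ContinuousOn invA {q | q.1 ≠ 0} := chartA.continuousOn_symm
  have hleft : ∀ U : SL2C, U.1 0 0 ≠ 0 → invA (U.1 0 0, U.1 0 1, U.1 1 0) = U :=
    fun U hU => chartA.left_inv hU
  rcases hm with hm | rfl
  · have h1 : IsPreconnected (Complex.slitPlane ×ˢ Complex.slitPlane ×ˢ (univ : Set ℂ)) :=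
      isPreconnected_slitPlane.prod (isPreconnected_slitPlane.prod isPreconnected_univ)
    -- When m₀₁ ≠ 0 the entries a, l = (m U)₀₀ and b are coordinates: c is recovered from l = m₀₀ a
    -- + m₀₁ c. In them the intersection is a product of two slit planes and a line.
    have h2 := h1.image (fun q => invA (q.1, q.2.2, (q.2.1 - m.1 0 0 * q.1) / m.1 0 1))
      (hcont.comp (by fun_prop) fun q hq => Complex.slitPlane_ne_zero hq.1)
    convert h2 using 1
    ext U
    constructor
    · rintro ⟨hU, hmU⟩
      refine ⟨(U.1 0 0, (m * U).1 0 0, U.1 0 1), ⟨hU, hmU, trivial⟩, ?_⟩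
      have : ((m * U).1 0 0 - m.1 0 0 * U.1 0 0) / m.1 0 1 = U.1 1 0 := by
        rw [hmul]; field_simp; ring
      simp only [this]
      exact hleft U (Complex.slitPlane_ne_zero hU)
    · rintro ⟨⟨a, l, b⟩, ⟨ha, hl, -⟩, rfl⟩
      have ha' := Complex.slitPlane_ne_zero ha
      simp only [mem_ofPred_eq, hmul, invA_val (q := (a, b, (l - m.1 0 0 * a) / m.1 0 1)) ha']
      refine ⟨ha, ?_⟩
      have : m.1 0 0 * a + m.1 0 1 * ((l - m.1 0 0 * a) / m.1 0 1) = l := by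
        field_simp; ring
      simpa [this] using hl
  · have h1 : IsPreconnected (Complex.slitPlane ×ˢ (univ : Set (ℂ × ℂ))) :=
      isPreconnected_slitPlane.prod isPreconnected_univ
    have h2 := h1.image invA (hcont.mono fun q hq => Complex.slitPlane_ne_zero hq.1)
    convert h2 using 1
    ext U
    simp only [one_mul, and_self, mem_ofPred_eq]
    constructor
    · intro hU
      exact ⟨(U.1 0 0, U.1 0 1, U.1 1 0), ⟨hU, trivial⟩, hleft U (Complex.slitPlane_ne_zero hU)⟩
    · rintro ⟨q, ⟨hq, -⟩, rfl⟩
      rw [invA_val (Complex.slitPlane_ne_zero hq)]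
      exact hq

theorem isPreconnected_slitDomain_inter (k k' : SL2C) (h : (k' * k⁻¹).1 0 1 ≠ 0 ∨ k' * k⁻¹ = 1) :
    IsPreconnected (slitDomain k ∩ slitDomain k') := by
  have h1 := (isPreconnected_slitDomain_inter_one (k' * k⁻¹) h).image (fun U => k⁻¹ * U)
    (contMDiff_mul_left k⁻¹).continuous.continuousOn
  convert h1 using 1
  ext U
  constructor
  · rintro ⟨h1, h2⟩
    refine ⟨k * U, ⟨h1, ?_⟩, inv_mul_cancel_left k U⟩
    rw [mul_assoc, inv_mul_cancel_left]
    exact h2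
  · rintro ⟨V, ⟨h1, h2⟩, rfl⟩
    refine ⟨?_, ?_⟩
    · rw [slitDomain, mem_ofPred_eq, mul_inv_cancel_left]
      exact h1
    · rw [mul_assoc] at h2
      exact h2

/-- Three elements of `SL(2, ℂ)` whose slit domains cover `SL(2, ℂ)`. -/
def slitIndex : Fin 3 → SL2C :=
  ![1, ⟨!![0, 1; -1, 0], by simp⟩, ⟨!![-1, -1; 0, -1], by simp⟩]

/-- A common point of the three slit domains. -/
def slitBase : SL2C := ⟨!![Complex.I, 0; Complex.I, -Complex.I], by simp⟩

/-- The three linear forms are a, c and -a-c, with values i, i and -2i at this point. -/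
theorem slitBase_mem (i : Fin 3) : slitBase ∈ slitDomain (slitIndex i) := by
  rw [mem_slitDomain_iff]
  fin_cases i <;> simp [slitIndex, slitBase, Complex.mem_slitPlane_iff]

/-- If a, c and -a-c all lay in (-∞, 0], then a and c would be nonpositive reals with nonnegative
sum, hence both zero, against determinant one. -/
theorem exists_mem_slitDomain (U : SL2C) : ∃ i, U ∈ slitDomain (slitIndex i) := by
  by_contra! h
  simp only [mem_slitDomain_iff, Complex.mem_slitPlane_iff] at h
  have h0 := h 0
  have h1 := h 1
  have h2 := h 2
  simp [slitIndex] at h0 h1 h2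
  have ha : U.1 0 0 = 0 := Complex.ext (by simp; linarith) h0.2
  have hc : U.1 1 0 = 0 := Complex.ext (by simp; linarith) h1.2
  simpa [ha, hc] using det_eq U

/-- Any two of the forms a, c, -a-c are linearly independent. -/
theorem isPreconnected_slitIndex_inter (i j : Fin 3) :
    IsPreconnected (slitDomain (slitIndex i) ∩ slitDomain (slitIndex j)) := by
  apply isPreconnected_slitDomain_inter
  rcases eq_or_ne i j with rfl | hij
  · exact Or.inr (mul_inv_cancel _)
  · left
    rw [mul_inv_zero_one]
    fin_cases i <;> fin_cases j <;> simp [slitIndex] at hij ⊢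

/-- Connectedness of SL(2, ℂ): each slit domain of the cover is connected and contains `slitBase`.
-/
theorem eq_of_eventually_eq {F : Type*} {h : SL2C → F}
    (hloc : ∀ g, ∀ᶠ g' in nhds g, h g' = h g) (g g' : SL2C) : h g = h g' := by
  have key : ∀ g, h g = h slitBase := fun g => by
    obtain ⟨i, hi⟩ := exists_mem_slitDomain g
    exact (isPreconnected_slitIndex_inter i i).eq_of_eventually_eq (fun g _ => hloc g) ⟨hi, hi⟩
      ⟨slitBase_mem i, slitBase_mem i⟩
  rw [key g, key g']

end SLTwo

/-! ### Frames which are parallel along the fibres of harmonic space -/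

namespace Volterra

section

variable {𝔸 : Type*} [NormedRing 𝔸] [NormedAlgebra ℂ 𝔸] [CompleteSpace 𝔸]

/-- The frame of `exists_parallel_frame`, normalised on a section `q = q₁`. -/
theorem exists_normalized_parallel_frame {Y Q : Type*} [NormedAddCommGroup Y] [NormedSpace ℂ Y]
    [NormedAddCommGroup Q] [NormedSpace ℂ Q] {T : Set Y} {S : Set Q} (hT : IsOpen T)
    (hS : IsOpen S) {q₀ : Q} (hq₀ : ∀ q ∈ S, ∀ t ∈ Icc (0 : ℝ) 1, q₀ + (t : ℂ) • (q - q₀) ∈ S)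
    {q₁ : Q} (hq₁ : q₁ ∈ S) {α : Y × Q → Y × Q →L[ℂ] 𝔸} (hα : ContDiffOn ℂ ∞ α (T ×ˢ S))
    (hF : ∀ z ∈ T ×ˢ S, ∀ v w : Q, flatCurvature α z (0, v) (0, w) = 0) :
    ∃ V : Y × Q → 𝔸ˣ, ContDiffOn ℂ ∞ (fun z => (V z : 𝔸)) (T ×ˢ S) ∧
      (∀ z ∈ T ×ˢ S, ∀ v : Q,
        fderiv ℂ (fun z => (V z : 𝔸)) z (0, v) = -(α z (0, v) * V z)) ∧
      ∀ y ∈ T, V (y, q₁) = 1 := by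
  obtain ⟨V, hV, hVd⟩ := exists_parallel_frame hT hS hq₀ hα hF
  have hΩ : IsOpen (T ×ˢ S) := hT.prod hS
  have h1 : ∀ z ∈ T ×ˢ S, ContDiffAt ℂ ∞ (fun z => (V z : 𝔸)) z :=
    fun z hz => hV.contDiffAt (hΩ.mem_nhds hz)
  have h2 : ∀ z ∈ T ×ˢ S,
      ContDiffAt ℂ ∞ (fun z : Y × Q => (((V (z.1, q₁))⁻¹ : 𝔸ˣ) : 𝔸)) z := fun z hz =>
    ContDiffAt.comp (f := fun z : Y × Q => (z.1, q₁)) (g := fun z => (((V z)⁻¹ : 𝔸ˣ) : 𝔸)) z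
      (contDiffAt_units_inv (h1 (z.1, q₁) ⟨hz.1, hq₁⟩)) (by fun_prop)
  -- Right multiplication by a function of y alone preserves the equation along the fibres, so the
  -- value at q₁ can be divided out.
  refine ⟨fun z => V z * (V (z.1, q₁))⁻¹, fun z hz => ?_, fun z hz v => ?_, fun y _ => ?_⟩
  · simp only [Units.val_mul]
    exact ((h1 z hz).mul (h2 z hz)).contDiffWithinAt
  · have e1 := ((h1 z hz).differentiableAt (by simp)).hasFDerivAt
    have e2 : HasFDerivAt (fun y => (((V (y, q₁))⁻¹ : 𝔸ˣ) : 𝔸)) _ z.1 :=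
      (DifferentiableAt.comp (f := fun y : Y => (y, q₁)) (g := fun z => (((V z)⁻¹ : 𝔸ˣ) : 𝔸)) z.1
        ((contDiffAt_units_inv (h1 (z.1, q₁) ⟨hz.1, hq₁⟩)).differentiableAt (by simp))
        (by fun_prop)).hasFDerivAt
    have e3 : HasFDerivAt (fun z : Y × Q => (((V (z.1, q₁))⁻¹ : 𝔸ˣ) : 𝔸)) _ z :=
      HasFDerivAt.comp (g := fun y => (((V (y, q₁))⁻¹ : 𝔸ˣ) : 𝔸)) (f := Prod.fst) z e2
        hasFDerivAt_fst
    have e4 : HasFDerivAt (fun z : Y × Q => ((V z * (V (z.1, q₁))⁻¹ : 𝔸ˣ) : 𝔸)) _ z := e1.mul' e3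
    rw [e4.fderiv]
    simp [hVd z hz v, mul_assoc]
  · simp

-- Two solutions of du = -a u differ by a right factor with zero derivative. This is the
-- infinitesimal form of the uniqueness of parallel frames.
set_option synthInstance.maxHeartbeats 400000 in
theorem hasMFDerivAt_inv_mul_zero {E : Type*} [NormedAddCommGroup E] [NormedSpace ℂ E]
    {H : Type*} [TopologicalSpace H] {I : ModelWithCorners ℂ E H}
    {N : Type*} [TopologicalSpace N] [ChartedSpace H N] {u u' : N → 𝔸ˣ} {x : N}
    {L L' : TangentSpace I x →L[ℂ] 𝔸}
    (hu : HasMFDerivAt I 𝓘(ℂ, 𝔸) (fun y => (u y : 𝔸)) x L)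
    (hu' : HasMFDerivAt I 𝓘(ℂ, 𝔸) (fun y => (u' y : 𝔸)) x L') {a : TangentSpace I x → 𝔸}
    (hL : ∀ v, L v = -(a v * u x)) (hL' : ∀ v, L' v = -(a v * u' x)) :
    HasMFDerivAt I 𝓘(ℂ, 𝔸) (fun y => (((u y)⁻¹ * u' y : 𝔸ˣ) : 𝔸)) x 0 := by
  have h1 : HasFDerivAt (fun q : 𝔸 × 𝔸 => Ring.inverse q.1) _ ((u x : 𝔸), (u' x : 𝔸)) :=
    HasFDerivAt.comp (g := Ring.inverse) (f := Prod.fst) ((u x : 𝔸), (u' x : 𝔸))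
      (hasFDerivAt_ringInverse (𝕜 := ℂ) (u x)) hasFDerivAt_fst
  obtain ⟨D, h2, hD⟩ : ∃ D : 𝔸 × 𝔸 →L[ℂ] 𝔸,
      HasFDerivAt (fun q : 𝔸 × 𝔸 => Ring.inverse q.1 * q.2) D ((u x : 𝔸), (u' x : 𝔸)) ∧
        ∀ a b, D (a, b) = ((u x)⁻¹ : 𝔸ˣ) * b
          + -(((u x)⁻¹ : 𝔸ˣ) * a * ((u x)⁻¹ : 𝔸ˣ)) * (u' x : 𝔸) :=
    ⟨_, h1.mul' hasFDerivAt_snd, fun a b => by simp⟩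
  have h4 : HasMFDerivAt I 𝓘(ℂ, 𝔸 × 𝔸) (fun y => ((u y : 𝔸), (u' y : 𝔸))) x (L.prod L') :=
    ⟨hu.1.prodMk hu'.1, hu.2.prodMk hu'.2⟩
  have h3 := HasMFDerivAt.comp (g := fun q : 𝔸 × 𝔸 => Ring.inverse q.1 * q.2)
    (f := fun y => ((u y : 𝔸), (u' y : 𝔸))) x h2.hasMFDerivAt h4
  refine (h3.congr_of_eventuallyEq (Filter.Eventually.of_forall fun y => by simp)).congr_mfderiv ?_
  ext v : 1
  have hv : -(((u x)⁻¹ : 𝔸ˣ) * L v * ((u x)⁻¹ : 𝔸ˣ)) * (u' x : 𝔸) + ((u x)⁻¹ : 𝔸ˣ) * L' v = 0 := by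
    rw [hL, hL']
    simp [mul_assoc]
  rw [add_comm] at hv
  exact (hD (L v) (L' v)).trans hv

end

end Volterra

/-! ### Local parallel frames over harmonic space and their gluing -/

namespace HalfFlat

open SLTwo Volterra

variable {E₀ : Type*} [NormedAddCommGroup E₀] [NormedSpace ℂ E₀]
  {M : Type*} [TopologicalSpace M] [ChartedSpace E₀ M]

/-- A parametrisation of an open subset of harmonic space. -/
def localParam (x₀ : M) (k : SL2C) (z : E₀ × ℂ × ℂ × ℂ) : Harmonic M :=
  ((extChartAt 𝓘(ℂ, E₀) x₀).symm z.1, slitParam k z.2)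

/-- The coordinates which are inverse to `localParam`. -/
def localCoord (x₀ : M) (k : SL2C) (p : Harmonic M) : E₀ × ℂ × ℂ × ℂ :=
  (extChartAt 𝓘(ℂ, E₀) x₀ p.1, slitCoord k p.2)

variable (E₀) in
/-- The range of `localParam`. -/
def localDomain (x₀ : M) (k : SL2C) : Set (Harmonic M) :=
  (extChartAt 𝓘(ℂ, E₀) x₀).source ×ˢ slitDomain k

variable (E₀) in
/-- The range of `localCoord`. -/
def localTarget (x₀ : M) : Set (E₀ × ℂ × ℂ × ℂ) :=
  (extChartAt 𝓘(ℂ, E₀) x₀).target ×ˢ slitTarget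

theorem isOpen_localDomain (x₀ : M) (k : SL2C) : IsOpen (localDomain E₀ x₀ k) :=
  (isOpen_extChartAt_source x₀).prod (isOpen_slitDomain k)

theorem isOpen_localTarget (x₀ : M) : IsOpen (localTarget E₀ x₀) :=
  (isOpen_extChartAt_target x₀).prod isOpen_slitTarget

theorem mem_chart_source_of_mem_localDomain {x₀ : M} {k : SL2C} {p : Harmonic M}
    (hp : p ∈ localDomain E₀ x₀ k) : p.1 ∈ (chartAt E₀ x₀).source := by
  rw [← extChartAt_source 𝓘(ℂ, E₀)]
  exact hp.1

theorem localCoord_mem {x₀ : M} {k : SL2C} {p : Harmonic M} (hp : p ∈ localDomain E₀ x₀ k) :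
    localCoord (E₀ := E₀) x₀ k p ∈ localTarget E₀ x₀ :=
  ⟨(extChartAt 𝓘(ℂ, E₀) x₀).map_source hp.1, slitCoord_mem k hp.2⟩

theorem localParam_localCoord {x₀ : M} {k : SL2C} {p : Harmonic M}
    (hp : p ∈ localDomain E₀ x₀ k) :
    localParam x₀ k (localCoord (E₀ := E₀) x₀ k p) = p :=
  Prod.ext ((extChartAt 𝓘(ℂ, E₀) x₀).left_inv hp.1) (slitParam_slitCoord k hp.2)

variable [IsManifold 𝓘(ℂ, E₀) ∞ M]

theorem contMDiffAt_localParam {x₀ : M} (k : SL2C) {z : E₀ × ℂ × ℂ × ℂ}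
    (hz : z ∈ localTarget E₀ x₀) :
    ContMDiffAt 𝓘(ℂ, E₀ × ℂ × ℂ × ℂ) (modelS E₀) ∞ (localParam x₀ k) z := by
  have h1 := ((contMDiffOn_extChartAt_symm (I := 𝓘(ℂ, E₀)) (n := ∞) x₀).contMDiffAt
    ((isOpen_extChartAt_target x₀).mem_nhds hz.1)).comp z contDiff_fst.contMDiff.contMDiffAt
  have h2 := (contMDiffAt_slitParam k hz.2).comp z contDiff_snd.contMDiff.contMDiffAt
  exact h1.prodMk h2

theorem contMDiffAt_localCoord {x₀ : M} {k : SL2C} {p : Harmonic M}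
    (hp : p ∈ localDomain E₀ x₀ k) :
    ContMDiffAt (modelS E₀) 𝓘(ℂ, E₀ × ℂ × ℂ × ℂ) ∞ (localCoord (E₀ := E₀) x₀ k) p := by
  have h1 := (contMDiffAt_extChartAt' (I := 𝓘(ℂ, E₀)) (n := ∞)
    (x := x₀) (x' := p.1) (mem_chart_source_of_mem_localDomain (E₀ := E₀) hp)).comp p
    (contMDiffAt_fst (I := 𝓘(ℂ, E₀)) (J := 𝓘(ℂ, ℂ × ℂ × ℂ)))
  have h2 := (contMDiffAt_slitCoord k hp.2).comp p
    (contMDiffAt_snd (I := 𝓘(ℂ, E₀)) (J := 𝓘(ℂ, ℂ × ℂ × ℂ)))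
  exact h1.prodMk_space h2

theorem mfderiv_fst_localParam_apply {x₀ : M} (k : SL2C) {z : E₀ × ℂ × ℂ × ℂ}
    (hz : z ∈ localTarget E₀ x₀) (v : E₀ × ℂ × ℂ × ℂ) :
    @Eq E₀ (mfderiv (modelS E₀) 𝓘(ℂ, E₀) (Prod.fst : Harmonic M → M) (localParam x₀ k z)
      (mfderiv 𝓘(ℂ, E₀ × ℂ × ℂ × ℂ) (modelS E₀) (localParam x₀ k) z v))
      (mfderiv 𝓘(ℂ, E₀) 𝓘(ℂ, E₀) (extChartAt 𝓘(ℂ, E₀) x₀).symm z.1 v.1) := by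
  have h1 := mfderiv_comp z (I := 𝓘(ℂ, E₀ × ℂ × ℂ × ℂ)) (I' := modelS E₀) (I'' := 𝓘(ℂ, E₀))
    (g := (Prod.fst : Harmonic M → M)) (f := localParam x₀ k) mdifferentiableAt_fst
    ((contMDiffAt_localParam k hz).mdifferentiableAt (by simp))
  have h2 := mfderiv_comp z (I := 𝓘(ℂ, E₀ × ℂ × ℂ × ℂ)) (I' := 𝓘(ℂ, E₀)) (I'' := 𝓘(ℂ, E₀))
    (g := (extChartAt 𝓘(ℂ, E₀) x₀).symm) (f := Prod.fst)
    (mdifferentiableAt_extChartAt_symm hz.1) differentiableAt_fst.mdifferentiableAt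
  have h3 := congrArg (fun L : E₀ × ℂ × ℂ × ℂ →L[ℂ] E₀ => L v) (h1.symm.trans h2)
  refine h3.trans ?_
  rw [mfderiv_eq_fderiv, fderiv_fst]
  rfl

theorem mfderiv_fst_localParam {x₀ : M} (k : SL2C) {z : E₀ × ℂ × ℂ × ℂ}
    (hz : z ∈ localTarget E₀ x₀) (v : ℂ × ℂ × ℂ) :
    mfderiv (modelS E₀) 𝓘(ℂ, E₀) (Prod.fst : Harmonic M → M) (localParam x₀ k z)
      (mfderiv 𝓘(ℂ, E₀ × ℂ × ℂ × ℂ) (modelS E₀) (localParam x₀ k) z ((0, v) : E₀ × ℂ × ℂ × ℂ))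
      = 0 :=
  (mfderiv_fst_localParam_apply k hz (0, v)).trans
    (map_zero (mfderiv 𝓘(ℂ, E₀) 𝓘(ℂ, E₀) (extChartAt 𝓘(ℂ, E₀) x₀).symm z.1))

theorem mfderiv_localCoord_of_vertical {x₀ : M} {k : SL2C} {p : Harmonic M}
    (hp : p ∈ localDomain E₀ x₀ k) {v : TangentSpace (modelS E₀) p}
    (hv : mfderiv (modelS E₀) 𝓘(ℂ, E₀) (Prod.fst : Harmonic M → M) p v = 0) :
    ∃ w : ℂ × ℂ × ℂ, @Eq (E₀ × ℂ × ℂ × ℂ)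
      (mfderiv (modelS E₀) 𝓘(ℂ, E₀ × ℂ × ℂ × ℂ) (localCoord (E₀ := E₀) x₀ k) p v) (0, w) := by
  let d : E₀ × ℂ × ℂ × ℂ := mfderiv (modelS E₀) 𝓘(ℂ, E₀ × ℂ × ℂ × ℂ) (localCoord (E₀ := E₀) x₀ k) p v
  have h1 := mfderiv_comp p (I := modelS E₀) (I' := 𝓘(ℂ, E₀ × ℂ × ℂ × ℂ)) (I'' := 𝓘(ℂ, E₀))
    (g := Prod.fst) (f := localCoord (E₀ := E₀) x₀ k) differentiableAt_fst.mdifferentiableAt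
    ((contMDiffAt_localCoord hp).mdifferentiableAt (by simp))
  have h2 := mfderiv_comp p (I := modelS E₀) (I' := 𝓘(ℂ, E₀)) (I'' := 𝓘(ℂ, E₀))
    (g := extChartAt 𝓘(ℂ, E₀) x₀) (f := (Prod.fst : Harmonic M → M))
    (mdifferentiableAt_extChartAt (mem_chart_source_of_mem_localDomain (E₀ := E₀) hp))
    mdifferentiableAt_fst
  have h3 := congrArg (fun L : E₀ × ℂ × ℂ × ℂ →L[ℂ] E₀ => L v) (h1.symm.trans h2)
  have h4 : d.1 = 0 := by
    rw [mfderiv_eq_fderiv, fderiv_fst] at h3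
    refine h3.trans ?_
    refine (congrArg (mfderiv 𝓘(ℂ, E₀) 𝓘(ℂ, E₀) (extChartAt 𝓘(ℂ, E₀) x₀) p.1) hv).trans ?_
    exact map_zero _
  exact ⟨d.2, Prod.ext h4 rfl⟩

variable {r : ℕ}

/-- The frame `U` is parallel at `p` along the fibre of `π : S_H → M`. -/
def IsVerticallyParallelAt (A : Potential (modelS E₀) (Harmonic M) r)
    (U : Harmonic M → (Gl r)ˣ) (p : Harmonic M) : Prop :=
  ∀ v : TangentSpace (modelS E₀) p,
    mfderiv (modelS E₀) 𝓘(ℂ, E₀) (Prod.fst : Harmonic M → M) p v = 0 →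
      mvfderiv (modelS E₀) (fun p => (U p : Gl r)) p v = -(A p v * U p)

/-- In the coordinates (chart of M, translated chart of SL(2, ℂ)) the fibres become the star-shaped
`slitTarget`, and vertical vectors correspond to vectors (0, w). The normalised frame on the normed
space is transported back. -/
theorem exists_local_frame {A : Potential (modelS E₀) (Harmonic M) r} (hA : IsHolomorphic A)
    (hV : VerticallyNull A) (x₀ : M) {k : SL2C} {g : SL2C} (hg : g ∈ slitDomain k) :
    ∃ U : Harmonic M → (Gl r)ˣ,
      (∀ p ∈ localDomain E₀ x₀ k,
        ContMDiffAt (modelS E₀) 𝓘(ℂ, Gl r) ∞ (fun p => (U p : Gl r)) p) ∧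
      (∀ p ∈ localDomain E₀ x₀ k, IsVerticallyParallelAt A U p) ∧
      ∀ x ∈ (extChartAt 𝓘(ℂ, E₀) x₀).source, U (x, g) = 1 := by
  have hΩ := isOpen_localTarget (E₀ := E₀) x₀
  obtain ⟨V, hVs, hVp, hV1⟩ := exists_normalized_parallel_frame (𝔸 := Gl r)
    (T := (extChartAt 𝓘(ℂ, E₀) x₀).target) (S := slitTarget)
    (isOpen_extChartAt_target x₀) isOpen_slitTarget slitTarget_star (slitCoord_mem k hg)
    (α := pullForm A (localParam x₀ k))
    (fun z hz => (hA.contDiffAt_pullForm (contMDiffAt_localParam k hz)).contDiffWithinAt)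
    (fun z hz v w => by
      rw [hA.flatCurvature_pullForm (contMDiffAt_localParam k hz)]
      exact hV _ _ _ (mfderiv_fst_localParam k hz v))
  refine ⟨fun p => V (localCoord (E₀ := E₀) x₀ k p), fun p hp => ?_, fun p hp v hv => ?_, fun x hx => ?_⟩
  · exact (hVs.contDiffAt (hΩ.mem_nhds (localCoord_mem hp))).comp_contMDiffAt
      (contMDiffAt_localCoord hp)
  · have hp' := localCoord_mem hp
    have hd := (contMDiffAt_localCoord hp).mdifferentiableAt (by simp)
    have hVd := (hVs.contDiffAt (hΩ.mem_nhds hp')).differentiableAt (by simp)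
    obtain ⟨w, hw⟩ := mfderiv_localCoord_of_vertical hp hv
    have h1 := mfderiv_comp p (I := modelS E₀) (I' := 𝓘(ℂ, E₀ × ℂ × ℂ × ℂ)) (I'' := 𝓘(ℂ, Gl r))
      (g := fun z => (V z : Gl r)) (f := localCoord (E₀ := E₀) x₀ k) hVd.mdifferentiableAt hd
    rw [mfderiv_eq_fderiv] at h1
    have h2 := congrArg (fun L : E₀ × ℂ × ℂ × ℂ →L[ℂ] Gl r => L v) h1
    refine h2.trans ?_
    refine (congrArg (fderiv ℂ (fun z => (V z : Gl r)) (localCoord (E₀ := E₀) x₀ k p)) hw).trans ?_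
    rw [hVp _ hp' w]
    have h3 : localParam x₀ k ∘ localCoord (E₀ := E₀) x₀ k =ᶠ[nhds p] id := by
      filter_upwards [(isOpen_localDomain x₀ k).mem_nhds hp] with q hq
      exact localParam_localCoord hq
    have h4 := mfderiv_comp p (I := modelS E₀) (I' := 𝓘(ℂ, E₀ × ℂ × ℂ × ℂ)) (I'' := modelS E₀)
      (g := localParam x₀ k) (f := localCoord (E₀ := E₀) x₀ k)
      ((contMDiffAt_localParam k hp').mdifferentiableAt (by simp)) hd
    have h5 : mfderiv (modelS E₀) (modelS E₀) (localParam x₀ k ∘ localCoord (E₀ := E₀) x₀ k) p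
        = ContinuousLinearMap.id ℂ (E₀ × ℂ × ℂ × ℂ) := h3.mfderiv_eq.trans mfderiv_id
    have h6 := congrArg (fun L : E₀ × ℂ × ℂ × ℂ →L[ℂ] E₀ × ℂ × ℂ × ℂ => L v) (h4.symm.trans h5)
    -- Parametrisation and coordinates are mutually inverse near p, so pulling `A` back and
    -- evaluating on the coordinate vector of v returns A(v).
    have h7 : pullForm A (localParam x₀ k) (localCoord (E₀ := E₀) x₀ k p) (0, w) = A p v := by
      rw [← hw]
      exact (congrArg (fun e : E₀ × ℂ × ℂ × ℂ => A (localParam x₀ k (localCoord (E₀ := E₀) x₀ k p)) e)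
        h6).trans (potential_apply_congr A (localParam_localCoord hp) v)
    rw [h7]
  · exact hV1 _ ((extChartAt 𝓘(ℂ, E₀) x₀).map_source hx)

omit [IsManifold 𝓘(ℂ, E₀) ∞ M] in
theorem mfderiv_fst_mk (x : M) (g : SL2C) (w : TangentSpace 𝓘(ℂ, ℂ × ℂ × ℂ) g) :
    mfderiv (modelS E₀) 𝓘(ℂ, E₀) (Prod.fst : Harmonic M → M) (x, g)
      (mfderiv 𝓘(ℂ, ℂ × ℂ × ℂ) (modelS E₀) (fun g : SL2C => ((x, g) : Harmonic M)) g w) = 0 := by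
  rw [mfderiv_prod_right, mfderiv_fst]
  rfl

-- On one fibre the quotient of two parallel frames is locally constant, hence constant on a
-- connected open set, and it equals 1 at g₁.
omit [IsManifold 𝓘(ℂ, E₀) ∞ M] in
theorem frame_unique {A : Potential (modelS E₀) (Harmonic M) r} {U U' : Harmonic M → (Gl r)ˣ}
    {x : M} {W : Set SL2C} (hW : IsOpen W) (hWc : IsPreconnected W)
    (hU : ∀ g ∈ W, MDifferentiableAt (modelS E₀) 𝓘(ℂ, Gl r) (fun p => (U p : Gl r)) (x, g))
    (hU' : ∀ g ∈ W, MDifferentiableAt (modelS E₀) 𝓘(ℂ, Gl r) (fun p => (U' p : Gl r)) (x, g))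
    (hp : ∀ g ∈ W, IsVerticallyParallelAt A U (x, g))
    (hp' : ∀ g ∈ W, IsVerticallyParallelAt A U' (x, g)) {g₁ : SL2C} (hg₁ : g₁ ∈ W)
    (h1 : U (x, g₁) = U' (x, g₁)) {g : SL2C} (hg : g ∈ W) : U (x, g) = U' (x, g) := by
  have hmk : ∀ g, MDifferentiableAt 𝓘(ℂ, ℂ × ℂ × ℂ) (modelS E₀)
      (fun g : SL2C => ((x, g) : Harmonic M)) g := fun g =>
    mdifferentiableAt_const.prodMk mdifferentiableAt_id
  have key : ∀ g ∈ W, HasMFDerivAt 𝓘(ℂ, ℂ × ℂ × ℂ) 𝓘(ℂ, Gl r)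
      (fun g => (((U (x, g))⁻¹ * U' (x, g) : (Gl r)ˣ) : Gl r)) g 0 := by
    intro g hg
    have e1 := (hU g hg).hasMFDerivAt.comp g (hmk g).hasMFDerivAt
    have e2 := (hU' g hg).hasMFDerivAt.comp g (hmk g).hasMFDerivAt
    exact hasMFDerivAt_inv_mul_zero (u := fun g => U (x, g)) (u' := fun g => U' (x, g)) e1 e2
      (fun w => hp g hg _ (mfderiv_fst_mk x g w)) (fun w => hp' g hg _ (mfderiv_fst_mk x g w))
  have hc := hWc.eq_of_eventually_eq
    (h := fun g => (((U (x, g))⁻¹ * U' (x, g) : (Gl r)ˣ) : Gl r)) (fun g hg =>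
      eventually_eq_of_mfderiv_eq_zero (I := 𝓘(ℂ, ℂ × ℂ × ℂ)) (by
        filter_upwards [hW.mem_nhds hg] with g' hg'
        exact ⟨(key g' hg').mdifferentiableAt, (key g' hg').mfderiv⟩)) hg hg₁
  rw [Units.val_inj, h1, inv_mul_cancel, inv_mul_eq_one] at hc
  exact hc

/-- A frame over harmonic space which is parallel along all fibres. -/
theorem exists_global_frame {A : Potential (modelS E₀) (Harmonic M) r} (hA : IsHolomorphic A)
    (hV : VerticallyNull A) :
    ∃ U : Harmonic M → (Gl r)ˣ,
      ContMDiff (modelS E₀) 𝓘(ℂ, Gl r) ∞ (fun p => (U p : Gl r)) ∧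
      ∀ p, IsVerticallyParallelAt A U p := by
  choose L hLs hLp hL1 using fun (x₀ : M) (i : Fin 3) =>
    exists_local_frame hA hV x₀ (slitBase_mem i)
  choose κ hκ using exists_mem_slitDomain
  -- All local frames equal 1 at `slitBase`, which lies in every slit domain of the cover. Since
  -- overlaps along a fibre are connected, uniqueness leaves no monodromy and no cocycle to
  -- trivialise.
  have hagree : ∀ (x₀ x₁ : M) (i j : Fin 3) (x : M) (g : SL2C),
      (x, g) ∈ localDomain E₀ x₀ (slitIndex i) → (x, g) ∈ localDomain E₀ x₁ (slitIndex j) →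
        L x₀ i (x, g) = L x₁ j (x, g) := by
    intro x₀ x₁ i j x g h0 h1
    refine frame_unique (A := A) (W := slitDomain (slitIndex i) ∩ slitDomain (slitIndex j))
      ((isOpen_slitDomain _).inter (isOpen_slitDomain _)) (isPreconnected_slitIndex_inter i j)
      (fun g hg => (hLs x₀ i (x, g) ⟨h0.1, hg.1⟩).mdifferentiableAt (by simp))
      (fun g hg => (hLs x₁ j (x, g) ⟨h1.1, hg.2⟩).mdifferentiableAt (by simp))
      (fun g hg => hLp x₀ i (x, g) ⟨h0.1, hg.1⟩) (fun g hg => hLp x₁ j (x, g) ⟨h1.1, hg.2⟩)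
      ⟨slitBase_mem i, slitBase_mem j⟩ ?_ ⟨h0.2, h1.2⟩
    rw [hL1 x₀ i x h0.1, hL1 x₁ j x h1.1]
  -- The frame used varies with the point, but by the agreement on overlaps U coincides near p with
  -- the one frame chosen at p, and inherits its regularity and parallelism.
  let U : Harmonic M → (Gl r)ˣ := fun p => L p.1 (κ p.2) p
  have hmem : ∀ p : Harmonic M, p ∈ localDomain E₀ p.1 (slitIndex (κ p.2)) :=
    fun p => ⟨mem_extChartAt_source p.1, hκ p.2⟩
  have hloc : ∀ p : Harmonic M,
      (fun q => (U q : Gl r)) =ᶠ[nhds p] fun q => (L p.1 (κ p.2) q : Gl r) := by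
    intro p
    filter_upwards [(isOpen_localDomain _ _).mem_nhds (hmem p)] with q hq
    exact congrArg Units.val (hagree q.1 p.1 (κ q.2) (κ p.2) q.1 q.2 (hmem q) hq)
  refine ⟨U, fun p => (hLs _ _ p (hmem p)).congr_of_eventuallyEq (hloc p), fun p v hv => ?_⟩
  rw [← hLp _ _ p (hmem p) v hv]
  exact congrArg (fun D : E₀ × ℂ × ℂ × ℂ →L[ℂ] Gl r => D v) (hloc p).mfderiv_eq

end HalfFlat

/-! ### Forms that vanish in the fibre directions -/

namespace Volterra

variable {𝔸 : Type*} [NormedRing 𝔸] [NormedAlgebra ℂ 𝔸]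
  {Y Q : Type*} [NormedAddCommGroup Y] [NormedSpace ℂ Y] [NormedAddCommGroup Q] [NormedSpace ℂ Q]

theorem flatCurvature_zero_left (α : Y → Y →L[ℂ] 𝔸) (z w : Y) : flatCurvature α z 0 w = 0 := by
  simp [flatCurvature]

theorem flatCurvature_add_smul_left (α : Y → Y →L[ℂ] 𝔸) (z : Y) (a b : ℂ) (v v' w : Y) :
    flatCurvature α z (a • v + b • v') w
      = a • flatCurvature α z v w + b • flatCurvature α z v' w := by
  simp only [flatCurvature, map_add, map_smul, add_apply, smul_apply, add_mul, mul_add,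
    smul_mul_assoc, mul_smul_comm, smul_add, smul_sub]
  abel

theorem flatCurvature_add_smul_right (α : Y → Y →L[ℂ] 𝔸) (z : Y) (a b : ℂ) (v w w' : Y) :
    flatCurvature α z v (a • w + b • w')
      = a • flatCurvature α z v w + b • flatCurvature α z v w' := by
  simp only [flatCurvature, map_add, map_smul, add_apply, smul_apply, add_mul, mul_add,
    smul_mul_assoc, mul_smul_comm, smul_add, smul_sub]
  abel

/-- When α(v) = 0 nearby for fibre directions v, both the commutator and the derivative of α(v) drop
out of F(v, w), leaving only the derivative of α(w) along v. -/
theorem fderiv_eq_zero_of_flatCurvature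
    {α : Y × Q → Y × Q →L[ℂ] 𝔸} {z : Y × Q} (hα : DifferentiableAt ℂ α z)
    (h0 : ∀ᶠ z in nhds z, ∀ v : Q, α z (0, v) = 0)
    (hF : ∀ (v : Q) (w : Y × Q), flatCurvature α z (0, v) w = 0) (v : Q) :
    fderiv ℂ α z (0, v) = 0 := by
  refine ContinuousLinearMap.ext fun w => ?_
  have h1 : fderiv ℂ α z w (0, v) = 0 := by
    have h2 : (fun z => α z (0, v)) =ᶠ[nhds z] fun _ => 0 := by
      filter_upwards [h0] with z hz using hz v
    have h3 := (hα.hasFDerivAt.clm_apply (hasFDerivAt_const ((0, v) : Y × Q) z)).fderiv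
    rw [h2.fderiv_eq] at h3
    have h4 := congrArg (fun L : Y × Q →L[ℂ] 𝔸 => L w) h3
    simpa using h4.symm
  have h5 := hF v w
  rw [flatCurvature, h1, h0.self_of_nhds v] at h5
  simpa using h5

theorem eventually_eq_of_fderiv_right_eq_zero {F : Type*} [NormedAddCommGroup F] [NormedSpace ℂ F]
    {α : Y × Q → F} {y : Y} {q₀ : Q}
    (hα : ∀ᶠ q in nhds q₀, DifferentiableAt ℂ α (y, q) ∧ ∀ v, fderiv ℂ α (y, q) (0, v) = 0) :
    ∀ᶠ q in nhds q₀, α (y, q) = α (y, q₀) := by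
  refine eventually_eq_of_fderiv_eq_zero (h := fun q => α (y, q)) ?_
  filter_upwards [hα] with q hq
  have e : HasFDerivAt (fun q => α (y, q)) _ q :=
    HasFDerivAt.comp (𝕜 := ℂ) (g := α) (f := fun q => (y, q))
      (f' := ContinuousLinearMap.inr ℂ Y Q) q hq.1.hasFDerivAt (hasFDerivAt_prodMk_right y q)
  refine ⟨e.differentiableAt, e.fderiv.trans ?_⟩
  refine ContinuousLinearMap.ext fun v => ?_
  exact hq.2 v

end Volterra

namespace HalfFlat

open SLTwo Volterra

/-! ### Pull-backs of potentials between manifolds -/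

section Pull

variable {E : Type*} [NormedAddCommGroup E] [NormedSpace ℂ E]
  {H : Type*} [TopologicalSpace H] {I : ModelWithCorners ℂ E H}
  {N : Type*} [TopologicalSpace N] [ChartedSpace H N]
  {E' : Type*} [NormedAddCommGroup E'] [NormedSpace ℂ E']
  {H' : Type*} [TopologicalSpace H'] {I' : ModelWithCorners ℂ E' H'}
  {N' : Type*} [TopologicalSpace N'] [ChartedSpace H' N'] {r : ℕ}

/-- The pull-back of a potential under a map of manifolds. -/
def pull (φ : N → N') (A : Potential I' N' r) : Potential I N r :=
  fun x => (A (φ x)).comp (mfderiv I I' φ x)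

theorem mfderiv_apply_congr (φ : N → N') {x y : N} (h : x = y) (v : E) :
    @Eq E' (mfderiv I I' φ x v) (mfderiv I I' φ y v) := by
  subst h; rfl

theorem curvature_congr (A : Potential I N r) {x y : N} (h : x = y) {v w v' w' : E} (hv : v = v')
    (hw : w = w') : curvature A x v w = curvature A y v' w' := by
  subst h hv hw; rfl

variable [I.Boundaryless] [IsManifold I ∞ N] [I'.Boundaryless] [IsManifold I' ∞ N']

omit [I'.Boundaryless] [IsManifold I' ∞ N'] in
theorem pull_gauge (φ : N → N') (hφ : ContMDiff I I' ∞ φ) (A : Potential I' N' r)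
    {U : N' → (Gl r)ˣ} (hU : ContMDiff I' 𝓘(ℂ, Gl r) ∞ (fun x => (U x : Gl r))) :
    pull (I := I) φ (gauge A U) = gauge (pull φ A) (fun x => U (φ x)) := by
  funext x
  ext v : 1
  have h := mfderiv_comp x (g := fun x => (U x : Gl r)) (f := φ)
    ((hU (φ x)).mdifferentiableAt (by simp)) ((hφ x).mdifferentiableAt (by simp))
  have h1 := congrArg (fun L : E →L[ℂ] Gl r => L v) h
  rw [gauge_apply]
  exact congrArg (fun d : Gl r => ((U (φ x))⁻¹ : (Gl r)ˣ) *
    (d + A (φ x) (mfderiv I I' φ x v) * U (φ x))) h1.symm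

theorem GaugeEquivalent.pull {φ : N → N'} (hφ : ContMDiff I I' ∞ φ) {A A' : Potential I' N' r}
    (h : GaugeEquivalent A A') : GaugeEquivalent (pull (I := I) φ A) (HalfFlat.pull φ A') := by
  obtain ⟨U, hU, rfl⟩ := gaugeEquivalent_iff.1 h
  exact gaugeEquivalent_iff.2 ⟨fun x => U (φ x), hU.comp hφ, pull_gauge φ hφ A hU⟩

omit [I'.Boundaryless] [IsManifold I' ∞ N'] in
theorem inChart_pull {φ : N → N'} (hφ : ContMDiff I I' ∞ φ) (A : Potential I' N' r) {x : N} {y : E}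
    (hy : y ∈ (extChartAt I x).target) :
    inChart (pull (I := I) φ A) x y = pullForm A (fun y => φ ((extChartAt I x).symm y)) y := by
  ext v : 1
  have h := mfderiv_comp y (I := 𝓘(ℂ, E)) (I' := I) (I'' := I') (g := φ)
    (f := (extChartAt I x).symm) ((hφ _).mdifferentiableAt (by simp))
    (mdifferentiableAt_extChartAt_symm hy)
  have h1 := congrArg (fun L : E →L[ℂ] E' => L v) h
  exact congrArg (fun d : E' => A (φ ((extChartAt I x).symm y)) d) h1.symm

omit [I'.Boundaryless] [IsManifold I' ∞ N'] in
theorem contMDiffAt_comp_extChartAt_symm {φ : N → N'} (hφ : ContMDiff I I' ∞ φ) {x : N} {y : E}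
    (hy : y ∈ (extChartAt I x).target) :
    ContMDiffAt 𝓘(ℂ, E) I' ∞ (fun y => φ ((extChartAt I x).symm y)) y :=
  (hφ _).comp y ((contMDiffOn_extChartAt_symm (n := ∞) x).contMDiffAt
    ((isOpen_extChartAt_target x).mem_nhds hy))

theorem IsHolomorphic.pull {φ : N → N'} (hφ : ContMDiff I I' ∞ φ) {A : Potential I' N' r}
    (hA : IsHolomorphic A) : IsHolomorphic (pull (I := I) φ A) := by
  intro x
  have h1 : ContDiffOn ℂ ∞ (pullForm A (fun y => φ ((extChartAt I x).symm y)))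
      (extChartAt I x).target := fun y hy =>
    (hA.contDiffAt_pullForm (contMDiffAt_comp_extChartAt_symm hφ hy)).contDiffWithinAt
  exact h1.congr fun y hy => inChart_pull hφ A hy

theorem IsHolomorphic.curvature_pull {φ : N → N'} (hφ : ContMDiff I I' ∞ φ)
    {A : Potential I' N' r} (hA : IsHolomorphic A) (x : N) (v w : E) :
    curvature (HalfFlat.pull (I := I) φ A) x v w
      = curvature A (φ x) (mfderiv I I' φ x v) (mfderiv I I' φ x w) := by
  have hx := mem_extChartAt_target (I := I) x
  have h1 : inChart (HalfFlat.pull (I := I) φ A) x =ᶠ[nhds (extChartAt I x x)]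
      pullForm A (fun y => φ ((extChartAt I x).symm y)) := by
    filter_upwards [(isOpen_extChartAt_target x).mem_nhds hx] with y hy
    exact inChart_pull hφ A hy
  have h2 := mfderiv_comp (extChartAt I x x) (I := 𝓘(ℂ, E)) (I' := I) (I'' := I') (g := φ)
    (f := (extChartAt I x).symm) ((hφ _).mdifferentiableAt (by simp))
    (mdifferentiableAt_extChartAt_symm hx)
  have h3 : ∀ v : E, @Eq E' (mfderiv 𝓘(ℂ, E) I' (fun y => φ ((extChartAt I x).symm y))
      (extChartAt I x x) v) (mfderiv I I' φ x v) := fun v => by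
    refine (congrArg (fun L : E →L[ℂ] E' => L v) h2).trans ?_
    refine (congrArg (mfderiv I I' φ ((extChartAt I x).symm (extChartAt I x x)))
      (mfderiv_extChartAt_symm_self x v)).trans ?_
    exact mfderiv_apply_congr (E := E) (E' := E') φ (extChartAt_to_inv x) v
  rw [curvature_eq_flatCurvature, flatCurvature_congr h1,
    hA.flatCurvature_pullForm (contMDiffAt_comp_extChartAt_symm hφ hx)]
  exact curvature_congr A (congrArg φ (extChartAt_to_inv x)) (h3 v) (h3 w)

end Pull

/-! ### Bilinearity of curvature -/

section Curvature

variable {E : Type*} [NormedAddCommGroup E] [NormedSpace ℂ E]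
  {H : Type*} [TopologicalSpace H] {I : ModelWithCorners ℂ E H}
  {N : Type*} [TopologicalSpace N] [ChartedSpace H N] {r : ℕ}

theorem curvature_swap (A : Potential I N r) (x : N) (v w : TangentSpace I x) :
    curvature A x w v = -curvature A x v w := by
  simp only [curvature, dForm]
  abel

variable [I.Boundaryless] [IsManifold I ∞ N]

theorem curvature_zero_left (A : Potential I N r) (x : N) (w : E) : curvature A x (0 : E) w = 0 :=
  (curvature_eq_flatCurvature A x 0 w).trans (flatCurvature_zero_left _ _ w)

theorem curvature_add_smul_left (A : Potential I N r) (x : N) (a b : ℂ) (v v' w : E) :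
    curvature A x (a • v + b • v') w = a • curvature A x v w + b • curvature A x v' w := by
  simp only [curvature_eq_flatCurvature]
  exact flatCurvature_add_smul_left (𝔸 := Gl r) _ _ a b v v' w

theorem curvature_add_smul_right (A : Potential I N r) (x : N) (a b : ℂ) (v w w' : E) :
    curvature A x v (a • w + b • w') = a • curvature A x v w + b • curvature A x v w' := by
  simp only [curvature_eq_flatCurvature]
  exact flatCurvature_add_smul_right (𝔸 := Gl r) _ _ a b v w w'

end Curvature

/-! ### Descent to the base of harmonic space -/

section Descent

variable {E₀ : Type*} [NormedAddCommGroup E₀] [NormedSpace ℂ E₀]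
  {M : Type*} [TopologicalSpace M] [ChartedSpace E₀ M] {r : ℕ}

theorem contMDiff_proj :
    ContMDiff (modelS E₀) 𝓘(ℂ, E₀) ∞ (Prod.fst : Harmonic M → M) := contMDiff_fst

theorem contMDiff_mk (g : SL2C) :
    ContMDiff 𝓘(ℂ, E₀) (modelS E₀) ∞ (fun x : M => ((x, g) : Harmonic M)) :=
  contMDiff_id.prodMk contMDiff_const

theorem mfderiv_proj_apply (p : Harmonic M) (v : E₀ × ℂ × ℂ × ℂ) :
    @Eq E₀ (mfderiv (modelS E₀) 𝓘(ℂ, E₀) (Prod.fst : Harmonic M → M) p v) v.1 := by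
  rw [mfderiv_fst]
  rfl

variable [IsManifold 𝓘(ℂ, E₀) ∞ M]

variable [FiniteDimensional ℂ E₀] in
theorem pull_mk_pullback (B : Potential 𝓘(ℂ, E₀) M r) (g : SL2C) :
    pull (fun x : M => ((x, g) : Harmonic M)) (pullback B) = B := by
  funext x
  refine ContinuousLinearMap.ext fun v => ?_
  exact congrArg (fun u : E₀ => B x u) (mfderiv_fst_horizontalLift ((x, g) : Harmonic M) v)

-- Gauge equivalences pull back along holomorphic maps: along π in one direction, along its section
-- x ↦ (x, 1) in the other.
variable [FiniteDimensional ℂ E₀] in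
theorem gaugeEquivalent_pullback_iff {B B' : Potential 𝓘(ℂ, E₀) M r} :
    GaugeEquivalent (pullback B) (pullback B') ↔ GaugeEquivalent B B' := by
  refine ⟨fun h => ?_, fun h => h.pull contMDiff_proj⟩
  have h1 := h.pull (contMDiff_mk (1 : SL2C))
  rwa [pull_mk_pullback, pull_mk_pullback] at h1

theorem IsHolomorphic.pullback {B : Potential 𝓘(ℂ, E₀) M r} (hB : IsHolomorphic B) :
    IsHolomorphic (pullback B) := hB.pull contMDiff_proj

theorem IsHolomorphic.curvature_pullback {B : Potential 𝓘(ℂ, E₀) M r} (hB : IsHolomorphic B)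
    (p : Harmonic M) (v w : TangentSpace (modelS E₀) p) :
    curvature (HalfFlat.pullback B) p v w = curvature B p.1
      (mfderiv (modelS E₀) 𝓘(ℂ, E₀) (Prod.fst : Harmonic M → M) p v)
      (mfderiv (modelS E₀) 𝓘(ℂ, E₀) (Prod.fst : Harmonic M → M) p w) :=
  hB.curvature_pull contMDiff_proj p v w

theorem IsHolomorphic.verticallyNull_pullback {B : Potential 𝓘(ℂ, E₀) M r} (hB : IsHolomorphic B) :
    VerticallyNull (HalfFlat.pullback B) := by
  intro p v w hv
  rw [hB.curvature_pullback, hv]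
  exact curvature_zero_left B p.1 _

omit [IsManifold 𝓘(ℂ, E₀) ∞ M] in
theorem potential_apply_eq_of_fst_eq {A : Potential (modelS E₀) (Harmonic M) r}
    (h0 : ∀ (p : Harmonic M) (v : TangentSpace (modelS E₀) p),
      mfderiv (modelS E₀) 𝓘(ℂ, E₀) (Prod.fst : Harmonic M → M) p v = 0 → A p v = 0)
    (p : Harmonic M) {v w : E₀ × ℂ × ℂ × ℂ} (h : v.1 = w.1) : A p v = A p w := by
  have h1 := h0 p (v - w : E₀ × ℂ × ℂ × ℂ) ((mfderiv_proj_apply (E₀ := E₀) p _).trans (sub_eq_zero.2 h))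
  have h2 : A p (v - w : E₀ × ℂ × ℂ × ℂ) = A p v - A p w := map_sub (A p) v w
  exact sub_eq_zero.1 (h2.symm.trans h1)

/-- In local coordinates the fibre derivatives of the coefficients vanish, so the coefficients are
locally constant along the fibre; connectedness of SL(2, ℂ) does the rest. -/
theorem horizontal_const {A : Potential (modelS E₀) (Harmonic M) r} (hA : IsHolomorphic A)
    (hV : VerticallyNull A)
    (h0 : ∀ (p : Harmonic M) (v : TangentSpace (modelS E₀) p),
      mfderiv (modelS E₀) 𝓘(ℂ, E₀) (Prod.fst : Harmonic M → M) p v = 0 → A p v = 0)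
    (x : M) (Y : E₀) (g g' : SL2C) :
    A (x, g) ((Y, 0) : E₀ × ℂ × ℂ × ℂ) = A (x, g') ((Y, 0) : E₀ × ℂ × ℂ × ℂ) := by
  refine SLTwo.eq_of_eventually_eq (h := fun g => A (x, g) ((Y, 0) : E₀ × ℂ × ℂ × ℂ))
    (fun g => ?_) g g'
  obtain ⟨i, hi⟩ := exists_mem_slitDomain g
  let k := slitIndex i
  have hΩ := isOpen_localTarget (E₀ := E₀) x
  let α := pullForm A (localParam (E₀ := E₀) x k)
  let y₀ : E₀ := extChartAt 𝓘(ℂ, E₀) x x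
  have hy₀ : y₀ ∈ (extChartAt 𝓘(ℂ, E₀) x).target := mem_extChartAt_target x
  have hα : ∀ z ∈ localTarget E₀ x, DifferentiableAt ℂ α z := fun z hz =>
    (hA.contDiffAt_pullForm (contMDiffAt_localParam k hz)).differentiableAt (by simp)
  have hd : ∀ z ∈ localTarget E₀ x, ∀ v, fderiv ℂ α z (0, v) = 0 := fun z hz v =>
    fderiv_eq_zero_of_flatCurvature (𝔸 := Gl r) (hα z hz) (by
      filter_upwards [hΩ.mem_nhds hz] with z' hz' v'
      exact h0 _ _ (mfderiv_fst_localParam k hz' v'))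
      (fun v w => by
        rw [hA.flatCurvature_pullForm (contMDiffAt_localParam k hz)]
        exact hV _ _ _ (mfderiv_fst_localParam k hz v)) v
  have hc : ∀ᶠ q in nhds (slitCoord k g), α (y₀, q) = α (y₀, slitCoord k g) := by
    refine eventually_eq_of_fderiv_right_eq_zero (α := α) ?_
    filter_upwards [isOpen_slitTarget.mem_nhds (slitCoord_mem k hi)] with q hq
    exact ⟨hα (y₀, q) ⟨hy₀, hq⟩, hd (y₀, q) ⟨hy₀, hq⟩⟩
  have hα' : ∀ g ∈ slitDomain k,
      α (y₀, slitCoord k g) (Y, 0) = A (x, g) ((Y, 0) : E₀ × ℂ × ℂ × ℂ) := by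
    intro g hg
    have hz : (y₀, slitCoord k g) ∈ localTarget E₀ x := ⟨hy₀, slitCoord_mem k hg⟩
    have e1 : localParam (E₀ := E₀) x k (y₀, slitCoord k g) = (x, g) :=
      localParam_localCoord (p := (x, g)) ⟨mem_extChartAt_source x, hg⟩
    have e2 := (mfderiv_proj_apply (E₀ := E₀) _ _).symm.trans
      ((mfderiv_fst_localParam_apply k hz (Y, 0)).trans (mfderiv_extChartAt_symm_self x Y))
    -- At the centre of the chart of M the pushed-forward coordinate vector has base component Y;
    -- whatever vertical component it has does not matter, as `A` annihilates it.
    exact (potential_apply_eq_of_fst_eq h0 _ (w := (Y, 0)) e2).trans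
      (potential_apply_congr A e1 (Y, 0))
  have hcont : ContinuousAt (slitCoord k) g := (contMDiffAt_slitCoord k hi).continuousAt
  filter_upwards [hcont.eventually hc, (isOpen_slitDomain k).mem_nhds hi] with g' hg' hgd
  rw [← hα' g' hgd, ← hα' g hi, hg']

variable [FiniteDimensional ℂ E₀] in
/-- A connection over harmonic space whose curvature and potential both vanish on vertical vectors
is a pull-back. -/
theorem eq_pullback {A : Potential (modelS E₀) (Harmonic M) r} (hA : IsHolomorphic A)
    (hV : VerticallyNull A)
    (h0 : ∀ (p : Harmonic M) (v : TangentSpace (modelS E₀) p),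
      mfderiv (modelS E₀) 𝓘(ℂ, E₀) (Prod.fst : Harmonic M → M) p v = 0 → A p v = 0) :
    A = pullback (pull (fun x : M => ((x, 1) : Harmonic M)) A) := by
  funext p
  refine ContinuousLinearMap.ext fun v => ?_
  -- A vector and its horizontal part differ by a vertical vector, on which `A` vanishes.
  have e1 : A p v = A p ((v.1, 0) : E₀ × ℂ × ℂ × ℂ) := potential_apply_eq_of_fst_eq h0 p rfl
  refine e1.trans ((horizontal_const hA hV h0 p.1 v.1 p.2 1).trans ?_)
  refine potential_apply_eq_of_fst_eq h0 (p.1, 1) ?_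
  have e2 := mfderiv_fst_horizontalLift ((p.1, 1) : Harmonic M)
    (mfderiv (modelS E₀) 𝓘(ℂ, E₀) (Prod.fst : Harmonic M → M) p v)
  exact ((mfderiv_proj_apply (E₀ := E₀) _ _).symm.trans (e2.trans (mfderiv_proj_apply (E₀ := E₀) p v))).symm

-- For a frame U parallel along the fibres, U⁻¹ dU + U⁻¹ A U vanishes on vertical vectors, and the
-- curvature condition survives because curvature is only conjugated.
variable [FiniteDimensional ℂ E₀] in
theorem exists_gauge_eq_pullback {A : Potential (modelS E₀) (Harmonic M) r} (hA : IsHolomorphic A)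
    (hV : VerticallyNull A) :
    ∃ (U : Harmonic M → (Gl r)ˣ) (B : Potential 𝓘(ℂ, E₀) M r),
      ContMDiff (modelS E₀) 𝓘(ℂ, Gl r) ∞ (fun p => (U p : Gl r)) ∧ IsHolomorphic B ∧
        pullback B = gauge A U := by
  obtain ⟨U, hU, hUp⟩ := exists_global_frame hA hV
  have h1 := hA.gauge hU
  have h2 : VerticallyNull (gauge A U) := fun p v w hv => by
    refine (hA.curvature_gauge hU p v w).trans ?_
    rw [hV p v w hv, mul_zero, zero_mul]
  refine ⟨U, _, hU, h1.pull (contMDiff_mk 1), (eq_pullback h1 h2 fun p v hv => ?_).symm⟩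
  rw [gauge_apply, hUp p v hv, neg_add_cancel, mul_zero]

end Descent

/-! ### Half-flat connections -/

section HalfFlatConnections

variable {E₀ : Type*} [NormedAddCommGroup E₀] [NormedSpace ℂ E₀] [FiniteDimensional ℂ E₀]
  {M : Type*} [TopologicalSpace M] [ChartedSpace E₀ M] [IsManifold 𝓘(ℂ, E₀) ∞ M]
  {F : Type*} [NormedAddCommGroup F] [NormedSpace ℂ F]
  {V : M → Type*} [TopologicalSpace (TotalSpace F V)]
  [∀ x, AddCommGroup (V x)] [∀ x, Module ℂ (V x)] [∀ x, TopologicalSpace (V x)]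
  [∀ x, IsTopologicalAddGroup (V x)] [∀ x, ContinuousSMul ℂ (V x)]
  [FiberBundle F V] [VectorBundle ℂ F V]
  {F' : Type*} [NormedAddCommGroup F'] [NormedSpace ℂ F']
  {K : M → Type*} [TopologicalSpace (TotalSpace F' K)]
  [∀ x, AddCommGroup (K x)] [∀ x, Module ℂ (K x)] [∀ x, TopologicalSpace (K x)]
  [∀ x, IsTopologicalAddGroup (K x)] [∀ x, ContinuousSMul ℂ (K x)]
  [FiberBundle F' K] [VectorBundle ℂ F' K]
  {G : HalfFlatGrassmann E₀ F V F' K} (s : G.ParallelFrame) {r : ℕ}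

theorem IsHolomorphic.curvature_pullback_horizontalLift {B : Potential 𝓘(ℂ, E₀) M r}
    (hB : IsHolomorphic B) (p : Harmonic M) (v w : TangentSpace 𝓘(ℂ, E₀) p.1) :
    curvature (HalfFlat.pullback B) p (horizontalLift p v) (horizontalLift p w)
      = curvature B p.1 v w := by
  rw [hB.curvature_pullback, mfderiv_fst_horizontalLift, mfderiv_fst_horizontalLift]

omit [FiniteDimensional ℂ E₀] in
theorem vec_add_smul (x : M) (e : V x) (a b : ℂ) (h k : K x) :
    G.vec x e (a • h + b • k) = a • G.vec x e h + b • G.vec x e k := by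
  simp only [HalfFlatGrassmann.vec, TensorProduct.tmul_add, TensorProduct.tmul_smul, map_add,
    map_smul]

theorem isHalfFlatS_pullback {B : Potential 𝓘(ℂ, E₀) M r} (hB : IsHolomorphic B)
    (h : G.IsHalfFlat B) : s.IsHalfFlatS (pullback B) := by
  refine ⟨fun p e e' => ?_, fun p e e' => ?_, fun p e e' => ?_, hB.verticallyNull_pullback⟩
  all_goals obtain ⟨S, hS, hF⟩ := h p.1
  · refine (hB.curvature_pullback_horizontalLift p _ _).trans ?_
    rw [hF, G.omega_alt p.1]
    exact zero_smul ℂ (S e e')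
  · refine (hB.curvature_pullback_horizontalLift p _ _).trans
      (Eq.trans ?_ (hB.curvature_pullback_horizontalLift p _ _).symm)
    rw [hF, hF, hS]
  · refine (hB.curvature_pullback_horizontalLift p _ _).trans ?_
    rw [hF, G.omega_alt p.1]
    exact zero_smul ℂ (S e e')

/-- Expand h and h' in the basis h₁, h₂. The diagonal terms vanish, and skew-symmetry of F together
with symmetry in e, e' makes the two mixed terms opposite, so the coefficient a b' - b a' that
remains is ω_H(h, h'). -/
theorem curvature_vec_expand (hF' : Module.finrank ℂ F' = 2) (B : Potential 𝓘(ℂ, E₀) M r) (x : M)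
    (h11 : ∀ e e', curvature B x (G.vec x e (s.h₁ x)) (G.vec x e' (s.h₁ x)) = 0)
    (h22 : ∀ e e', curvature B x (G.vec x e (s.h₂ x)) (G.vec x e' (s.h₂ x)) = 0)
    (h12 : ∀ e e', curvature B x (G.vec x e (s.h₁ x)) (G.vec x e' (s.h₂ x))
      = curvature B x (G.vec x e' (s.h₁ x)) (G.vec x e (s.h₂ x))) (e e' : V x) (h h' : K x) :
    curvature B x (G.vec x e h) (G.vec x e' h')
      = G.omega x h h' • curvature B x (G.vec x e (s.h₁ x)) (G.vec x e' (s.h₂ x)) := by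
  have h21 : curvature B x (G.vec x e (s.h₂ x)) (G.vec x e' (s.h₁ x))
      = -curvature B x (G.vec x e (s.h₁ x)) (G.vec x e' (s.h₂ x)) := by
    rw [curvature_swap, h12]
  have w12 := s.symplectic x
  have w21 : G.omega x (s.h₂ x) (s.h₁ x) = -1 := by
    rw [← (G.omega_alt x).neg, w12]
  have key : ∀ a b a' b' : ℂ,
      curvature B x (G.vec x e (a • s.h₁ x + b • s.h₂ x))
          (G.vec x e' (a' • s.h₁ x + b' • s.h₂ x))
        = G.omega x (a • s.h₁ x + b • s.h₂ x) (a' • s.h₁ x + b' • s.h₂ x)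
          • curvature B x (G.vec x e (s.h₁ x)) (G.vec x e' (s.h₂ x)) := by
    intro a b a' b'
    rw [vec_add_smul, vec_add_smul]
    refine (curvature_add_smul_left B x a b _ _ _).trans ?_
    refine (congrArg₂ (fun X Y : Gl r => a • X + b • Y)
      (curvature_add_smul_right B x a' b' _ _ _) (curvature_add_smul_right B x a' b' _ _ _)).trans ?_
    have w : G.omega x (a • s.h₁ x + b • s.h₂ x) (a' • s.h₁ x + b' • s.h₂ x) = a * b' - b * a' := by
      simp only [map_add, map_smul, LinearMap.add_apply, LinearMap.smul_apply, smul_eq_mul,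
        G.omega_alt x (s.h₁ x), G.omega_alt x (s.h₂ x), w12, w21]
      ring
    rw [h11, h22, h21, w]
    have comb : ∀ {W : Type} [AddCommGroup W] [Module ℂ W] (C : W),
        a • (a' • (0 : W) + b' • C) + b • (a' • -C + b' • (0 : W)) = (a * b' - b * a') • C := by
      intros
      module
    exact comb _
  have h3 := key (G.omega x h (s.h₂ x)) (G.omega x (s.h₁ x) h) (G.omega x h' (s.h₂ x))
    (G.omega x (s.h₁ x) h')
  rwa [← s.expand hF' x h, ← s.expand hF' x h'] at h3

/-- It suffices to use the conditions over (x, 1), where the basis (h₊, h₋) is (h₁, h₂). -/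
theorem isHalfFlat_of_isHalfFlatS_pullback (hF' : Module.finrank ℂ F' = 2)
    {B : Potential 𝓘(ℂ, E₀) M r} (hB : IsHolomorphic B) (h : s.IsHalfFlatS (pullback B)) :
    G.IsHalfFlat B := by
  intro x
  have hp : s.hPlus ((x, 1) : Harmonic M) = s.h₁ x := by
    simp [HalfFlatGrassmann.ParallelFrame.hPlus]
  have hm : s.hMinus ((x, 1) : Harmonic M) = s.h₂ x := by
    simp [HalfFlatGrassmann.ParallelFrame.hMinus]
  obtain ⟨hpp, hpm, hmm, -⟩ := h
  have h11 : ∀ e e', curvature B x (G.vec x e (s.h₁ x)) (G.vec x e' (s.h₁ x)) = 0 := by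
    intro e e'
    rw [← hp]
    exact (hB.curvature_pullback_horizontalLift (x, 1) _ _).symm.trans (hpp (x, 1) e e')
  have h22 : ∀ e e', curvature B x (G.vec x e (s.h₂ x)) (G.vec x e' (s.h₂ x)) = 0 := by
    intro e e'
    rw [← hm]
    exact (hB.curvature_pullback_horizontalLift (x, 1) _ _).symm.trans (hmm (x, 1) e e')
  have h12 : ∀ e e', curvature B x (G.vec x e (s.h₁ x)) (G.vec x e' (s.h₂ x))
      = curvature B x (G.vec x e' (s.h₁ x)) (G.vec x e (s.h₂ x)) := by
    intro e e'
    rw [← hp, ← hm]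
    exact (hB.curvature_pullback_horizontalLift (x, 1) _ _).symm.trans
      ((hpm (x, 1) e e').trans (hB.curvature_pullback_horizontalLift (x, 1) _ _))
  exact ⟨fun e e' => curvature B x (G.vec x e (s.h₁ x)) (G.vec x e' (s.h₂ x)), h12,
    curvature_vec_expand s hF' B x h11 h22 h12⟩

-- A gauge transformation conjugates the curvature by U(p), and every half-flatness condition is a
-- vanishing or an equality of curvature values at one point.
omit [FiniteDimensional ℂ E₀] in
theorem isHalfFlatS_gauge {A : Potential (modelS E₀) (Harmonic M) r} (hA : IsHolomorphic A)
    {U : Harmonic M → (Gl r)ˣ} (hU : ContMDiff (modelS E₀) 𝓘(ℂ, Gl r) ∞ (fun p => (U p : Gl r)))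
    (h : s.IsHalfFlatS A) : s.IsHalfFlatS (gauge A U) := by
  have h0 : ∀ (p : Harmonic M) (v w : TangentSpace (modelS E₀) p), curvature A p v w = 0 →
      curvature (gauge A U) p v w = 0 := fun p v w hvw =>
    (hA.curvature_gauge hU p v w).trans (by rw [hvw, mul_zero, zero_mul])
  obtain ⟨hpp, hpm, hmm, hv⟩ := h
  refine ⟨fun p e e' => h0 p _ _ (hpp p e e'), fun p e e' => ?_,
    fun p e e' => h0 p _ _ (hmm p e e'), fun p v w hvw => h0 p v w (hv p v w hvw)⟩
  refine (hA.curvature_gauge hU p _ _).trans (Eq.trans ?_ (hA.curvature_gauge hU p _ _).symm)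
  rw [hpm]

end HalfFlatConnections

end HalfFlat

end

open HalfFlat in
theorem mainTheorem9
    {E₀ : Type*} [NormedAddCommGroup E₀] [NormedSpace ℂ E₀] [FiniteDimensional ℂ E₀]
    {M : Type*} [TopologicalSpace M] [ChartedSpace E₀ M] [IsManifold 𝓘(ℂ, E₀) ∞ M]
    {F : Type*} [NormedAddCommGroup F] [NormedSpace ℂ F] [FiniteDimensional ℂ F]
    {V : M → Type*} [TopologicalSpace (TotalSpace F V)]
    [∀ x, AddCommGroup (V x)] [∀ x, Module ℂ (V x)] [∀ x, TopologicalSpace (V x)]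
    [∀ x, IsTopologicalAddGroup (V x)] [∀ x, ContinuousSMul ℂ (V x)]
    [FiberBundle F V] [VectorBundle ℂ F V] [ContMDiffVectorBundle ∞ F V 𝓘(ℂ, E₀)]
    {F' : Type*} [NormedAddCommGroup F'] [NormedSpace ℂ F'] (hF' : Module.finrank ℂ F' = 2)
    {K : M → Type*} [TopologicalSpace (TotalSpace F' K)]
    [∀ x, AddCommGroup (K x)] [∀ x, Module ℂ (K x)] [∀ x, TopologicalSpace (K x)]
    [∀ x, IsTopologicalAddGroup (K x)] [∀ x, ContinuousSMul ℂ (K x)]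
    [FiberBundle F' K] [VectorBundle ℂ F' K] [ContMDiffVectorBundle ∞ F' K 𝓘(ℂ, E₀)]
    (G : HalfFlatGrassmann E₀ F V F' K) (hG : G.Admissible) (s : G.ParallelFrame) (r : ℕ) :
    -- every half-flat connection over `S_H` is gauge equivalent to the pull-back of a half-flat one
    (∀ A : Potential (modelS E₀) (Harmonic M) r, IsHolomorphic A → s.IsHalfFlatS A →
      ∃ B : Potential 𝓘(ℂ, E₀) M r, IsHolomorphic B ∧ G.IsHalfFlat B ∧
        GaugeEquivalent A (pullback B)) ∧
    -- a connection over `M` is half-flat if and only if its pull-back is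
    (∀ B : Potential 𝓘(ℂ, E₀) M r, IsHolomorphic B →
      (G.IsHalfFlat B ↔ s.IsHalfFlatS (pullback B))) ∧
    -- pull-back induces a bijection from the gauge equivalence classes of connections over `M` onto
    -- those of connections over `S_H` with `F(v, ·) = 0` for vertical `v`
    (∀ B : Potential 𝓘(ℂ, E₀) M r, IsHolomorphic B →
      IsHolomorphic (pullback B) ∧ VerticallyNull (pullback B)) ∧
    (∀ B B' : Potential 𝓘(ℂ, E₀) M r, IsHolomorphic B → IsHolomorphic B' →
      (GaugeEquivalent B B' ↔ GaugeEquivalent (pullback B) (pullback B'))) ∧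
    (∀ A : Potential (modelS E₀) (Harmonic M) r, IsHolomorphic A → VerticallyNull A →
      ∃ B : Potential 𝓘(ℂ, E₀) M r, IsHolomorphic B ∧ GaugeEquivalent A (pullback B)) := by
  refine ⟨fun A hA hAf => ?_, fun B hB => ?_, fun B hB => ?_, fun B B' _ _ => ?_, fun A hA hV => ?_⟩
  · obtain ⟨U, B, hU, hB, hBA⟩ := exists_gauge_eq_pullback hA hAf.2.2.2
    refine ⟨B, hB, isHalfFlat_of_isHalfFlatS_pullback s hF' hB ?_,
      gaugeEquivalent_iff.2 ⟨U, hU, hBA⟩⟩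
    rw [hBA]
    exact isHalfFlatS_gauge s hA hU hAf
  · exact ⟨isHalfFlatS_pullback s hB, isHalfFlat_of_isHalfFlatS_pullback s hF' hB⟩
  · exact ⟨hB.pullback, hB.verticallyNull_pullback⟩
  · exact gaugeEquivalent_pullback_iff.symm
  · obtain ⟨U, B, hU, hB, hBA⟩ := exists_gauge_eq_pullback hA hV
    exact ⟨B, hB, gaugeEquivalent_iff.2 ⟨U, hU, hBA⟩⟩
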